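/- Let $K_G,K_H\in\mathbb R$ and $m>0$. There is a constant $C>0$, depending only on $K_G$, $K_H$ and $m$, with the following property. Let $d\in\mathbb N$, and let $H:\mathbb R^d\times\mathbb R^d\to\mathbb R$ and $G:\mathbb R^d\to\mathbb R$ be $C^2$ functions with $\|D^2H\|_\infty\le K_H$ and $\|D^2G\|_\infty\le K_G$, such that $H(x,\cdot)$ is strongly convex with modulus $m$ for every $x$ (that is, $\partial_{pp}H\ge m\,I$). Let $\alpha>C$, and let $\tilde H$ be either of the two functions $$\tilde H(x,p)=H(x,p)+\alpha\,x\cdot p\qquad\text{or}\qquad \tilde H(x,p)=H(x,p)-\alpha\frac{|x|^2}{2}.$$ Then, for every $T>0$, the Hamilton--Jacobi--Bellman problem $$-\partial_t u(t,x)+\tilde H(x,\partial_x u(t,x))=0\ \text{ for }(t,x)\in(0,T)\times\mathbb R^d,\qquad u(T,x)=G(x)\ \text{ for }x\in\mathbb R^d,$$ is well-posed in the class $C^{1,1}_{\rm loc}([0,T]\times\mathbb R^d)$: there is exactly one function $u:[0,T]\times\mathbb R^d\to\mathbb R$ that is differentiable on $[0,T]\times\mathbb R^d$ (one-sidedly in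 time at $t=0$ and $t=T$), has a locally Lipschitz derivative there, and solves this problem classically. -/

import Mathlib

/-- `u` is of class `C^{1,1}_loc` on the set `s`: it is differentiable on `s` (one-sidedly at
boundary points) and its derivative is locally Lipschitz on `s`.  It is used for
`s = [0,T] × ℝ^d` with `T > 0`, where derivatives within `s` are unique. -/
def IsC11LocOn {V : Type*} [NormedAddCommGroup V] [NormedSpace ℝ V]
    (u : V → ℝ) (s : Set V) : Prop :=
  DifferentiableOn ℝ u s ∧ LocallyLipschitzOn s (fderivWithin ℝ u s)

/-- The closed space-time strip `[0,T] × ℝ^d`. -/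
def strip (d : ℕ) (T : ℝ) : Set (ℝ × EuclideanSpace ℝ (Fin d)) :=
  Set.Icc 0 T ×ˢ Set.univ

/-- `u` is a classical solution, of class `C^{1,1}_loc([0,T] × ℝ^d)`, of the
Hamilton-Jacobi-Bellman problem `-∂ₜu(t,x) + H(x, ∂ₓu(t,x)) = 0` in `(0,T) × ℝ^d`,
`u(T,x) = G(x)` on `ℝ^d`. -/
structure IsC11LocSolutionHJB {d : ℕ}
    (H : EuclideanSpace ℝ (Fin d) × EuclideanSpace ℝ (Fin d) → ℝ)
    (G : EuclideanSpace ℝ (Fin d) → ℝ) (T : ℝ)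
    (u : ℝ × EuclideanSpace ℝ (Fin d) → ℝ) : Prop where
  regular : IsC11LocOn u (strip d T)
  equation : ∀ t ∈ Set.Ioo 0 T, ∀ x : EuclideanSpace ℝ (Fin d),
    -deriv (fun s : ℝ => u (s, x)) t
      + H (x, gradient (fun y : EuclideanSpace ℝ (Fin d) => u (t, y)) x) = 0
  terminal : ∀ x : EuclideanSpace ℝ (Fin d), u (T, x) = G x

/-- Well-posedness on `[0,T] × ℝ^d` in the class `C^{1,1}_loc`: a classical solution in this class
exists, and any two of them coincide on `[0,T] × ℝ^d`. -/
def WellPosedHJB {d : ℕ}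
    (H : EuclideanSpace ℝ (Fin d) × EuclideanSpace ℝ (Fin d) → ℝ)
    (G : EuclideanSpace ℝ (Fin d) → ℝ) (T : ℝ) : Prop :=
  ∃ u : ℝ × EuclideanSpace ℝ (Fin d) → ℝ, IsC11LocSolutionHJB H G T u ∧
    ∀ v : ℝ × EuclideanSpace ℝ (Fin d) → ℝ, IsC11LocSolutionHJB H G T v →
      Set.EqOn v u (strip d T)

/-! The method is that of characteristics. For a Hamiltonian `F` with Lipschitz gradient, the system
`X' = -∂ₚF`, `P' = ∂ₓF` with end data `(y, ∇G(y))` at time `T` has global solutions. A solution `u`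
should satisfy `P = ∂ₓu(t, X)`, so the only obstruction to long-time existence is that the images of
the terminal graph stop being Lipschitz graphs over position.

Large `α` removes this obstruction. For each perturbation there is a quadratic form `q` which is
positive on differences of points of the terminal graph, nonincreasing in `t` along differences of
characteristics, and at most a multiple of `‖δ‖ ‖δ.1‖`. Going back from `T`, `q` can only grow, so
the position difference controls the whole difference
(`IsCharacteristicFlow.isGraphFlow_of_antitone`). For `α x·p` the form is `M²|x|² - |p|²`, since the
perturbation contracts `x` and expands `p` forward in time. For `-α|x|²/2` it is `p·x + M|x|²`,
where strong convexity controls `|p|²` and `α` controls `|x|²`. The thresholds on `α` do not involve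
`d` or `T`.

Under the graph property the position maps are bijections, the costate is a locally Lipschitz
function of `(t, x)`, and the action along characteristics is a `C^{1,1}_loc` solution `u` with that
costate as gradient.

Uniqueness needs no growth condition on a competitor `v`. Along a characteristic of `u`, convexity
makes `u - v` nonincreasing, hence `u ≥ v`. A nonnegative function with locally Lipschitz gradient
satisfies `|∇w|² ≤ C w` locally, so the rate of decrease of `u - v` is at most a multiple of `u -
v`, and Grönwall's argument gives `u = v` (`eqOn_of_characteristics`). -/

open Set Filter Topology
open scoped NNReal

/-! ### Globally Lipschitz ordinary differential equations -/

section ODE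

variable {W : Type*} [NormedAddCommGroup W] [NormedSpace ℝ W]

/-- A globally Lipschitz `C¹` vector field on a Banach space has global integral curves. -/
theorem exists_integralCurve_of_lipschitz [CompleteSpace W] {V : W → W} {L : ℝ≥0}
    (hV : ContDiff ℝ 1 V) (hL : LipschitzWith L V) (t₀ : ℝ) (z : W) :
    ∃ γ : ℝ → W, γ t₀ = z ∧ ∀ t, HasDerivAt γ (V (γ t)) t := by
  set ε : ℝ := 1 / (L + 1) with hε
  have hL0 : (0 : ℝ) < L + 1 := by positivity
  have hε0 : 0 < ε := by positivity
  have hlocal : ∀ x : W, ∃ γ : ℝ → W, γ 0 = x ∧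
      IsMIntegralCurveOn (I := modelWithCornersSelf ℝ W) γ V (Ioo (-ε) ε) := by
    intro x
    -- On the ball of radius `‖V x‖` about `x` the speed is at most `(L + 1)‖V x‖`, so the existence
    -- time `1 / (L + 1)` does not depend on `x`. Uniform local existence then yields global curves.
    have hpl : IsPicardLindelof (fun _ : ℝ => V) (tmin := -ε) (tmax := ε)
        ⟨0, by constructor <;> linarith⟩ x ‖V x‖₊ 0 (L * ‖V x‖₊ + ‖V x‖₊) L := by
      refine IsPicardLindelof.of_time_independent (fun y hy => ?_) hL.lipschitzOnWith ?_
      · have h1 := hL.dist_le_mul y x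
        rw [Metric.mem_closedBall] at hy
        have h2 : (L : ℝ) * dist y x ≤ L * ‖V x‖₊ := by gcongr
        have h3 : ‖V y‖ ≤ ‖V y - V x‖ + ‖V x‖ := by
          simpa using norm_add_le (V y - V x) (V x)
        rw [dist_eq_norm] at h1
        push_cast
        simp only [coe_nnnorm] at h2 ⊢
        linarith
      · simp only [sub_zero, zero_sub, neg_neg, max_self, NNReal.coe_zero]
        push_cast
        rw [hε]
        apply le_of_eq
        field_simp
    obtain ⟨γ, hγ0, hγ⟩ := hpl.exists_eq_forall_mem_Icc_hasDerivWithinAt₀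
    refine ⟨γ, hγ0, fun t ht => ?_⟩
    exact ((hγ t (Ioo_subset_Icc_self ht)).mono Ioo_subset_Icc_self).hasFDerivWithinAt.hasMFDerivWithinAt
  obtain ⟨γ, hγ0, hγ⟩ := exists_isMIntegralCurve_of_isMIntegralCurveOn
    (I := modelWithCornersSelf ℝ W) (v := V) (contMDiff_vectorSpace_iff_contDiff.2 hV) hε0 hlocal z
  refine ⟨fun t => γ (t - t₀), by simpa using hγ0, fun t => ?_⟩
  have h1 : HasFDerivAt γ (ContinuousLinearMap.toSpanSingleton ℝ (V (γ (t - t₀)))) (t - t₀) :=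
    (hasMFDerivAt_iff_hasFDerivAt.1 (hγ (t - t₀))).congr_fderiv (by
      ext; exact congrArg _ rfl)
  have h2 : HasDerivAt γ (V (γ (t - t₀))) (t - t₀) := h1
  exact h2.comp_sub_const t t₀

/-- Two-sided Grönwall estimate for two integral curves of a Lipschitz vector field. -/
theorem norm_sub_le_exp_of_integralCurves {V : W → W} {L : ℝ≥0} (hL : LipschitzWith L V)
    {γ η : ℝ → W} (hγ : ∀ t, HasDerivAt γ (V (γ t)) t) (hη : ∀ t, HasDerivAt η (V (η t)) t)
    (s t : ℝ) : ‖γ t - η t‖ ≤ Real.exp (L * |t - s|) * ‖γ s - η s‖ := by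
  have cont : ∀ {V' : W → W} {ζ : ℝ → W}, (∀ t, HasDerivAt ζ (V' (ζ t)) t) → Continuous ζ :=
    fun h => continuous_iff_continuousAt.2 fun t => (h t).continuousAt
  rcases le_total s t with h | h
  · have := dist_le_of_trajectories_ODE (v := fun _ => V) (a := s) (b := t) (fun _ => hL)
      (cont hγ).continuousOn (fun t _ => (hγ t).hasDerivWithinAt)
      (cont hη).continuousOn (fun t _ => (hη t).hasDerivWithinAt) le_rfl t ⟨h, le_rfl⟩
    rw [abs_of_nonneg (by linarith), mul_comm]
    simpa [dist_eq_norm] using this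
  -- Backward in time, the forward estimate applies to the reversed curves, which follow `-V`.
  · have rev : ∀ {ζ : ℝ → W}, (∀ t, HasDerivAt ζ (V (ζ t)) t) →
        ∀ t, HasDerivAt (fun r => ζ (-r)) (-V (ζ (-t))) t := fun {ζ} h t => by
      have := (h (-t)).scomp t (hasDerivAt_neg t)
      rw [neg_one_smul] at this
      exact this
    have := dist_le_of_trajectories_ODE (v := fun _ z => -V z) (a := -s) (b := -t) (K := L)
      (fun _ => hL.neg)
      (cont (V' := fun z => -V z) (rev hγ)).continuousOn
      (fun t _ => (rev hγ t).hasDerivWithinAt)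
      (cont (V' := fun z => -V z) (rev hη)).continuousOn
      (fun t _ => (rev hη t).hasDerivWithinAt) le_rfl (-t) ⟨by linarith, le_rfl⟩
    rw [abs_of_nonpos (by linarith), mul_comm]
    have e : -(t - s) = -t - -s := by ring
    rw [e]
    simpa [dist_eq_norm] using this

end ODE

/-! ### Functions with Lipschitz partial gradients -/

section PartialGradients

variable {E : Type*} [NormedAddCommGroup E] [InnerProductSpace ℝ E]

/-- The linear form `(ξ, η) ↦ ⟪v, ξ⟫ + ⟪w, η⟫`. -/
noncomputable def pairForm (v w : E) : E × E →L[ℝ] ℝ :=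
  (innerSL ℝ v).comp (ContinuousLinearMap.fst ℝ E E) +
    (innerSL ℝ w).comp (ContinuousLinearMap.snd ℝ E E)

@[simp]
theorem pairForm_apply (v w : E) (z : E × E) :
    pairForm v w z = inner ℝ v z.1 + inner ℝ w z.2 := rfl

/-- `F` is differentiable on `E × E` with partial gradients `a` and `b`, and these are Lipschitz
with constant `L`. -/
structure HasLipschitzPartialGradients (F : E × E → ℝ) (a b : E × E → E) (L : ℝ≥0) : Prop where
  hasFDerivAt : ∀ z, HasFDerivAt F (pairForm (a z) (b z)) z
  lipschitz_fst : LipschitzWith L a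
  lipschitz_snd : LipschitzWith L b

/-- The Hamiltonian vector field of the equation `-∂ₜu + F(x, ∂ₓu) = 0`. -/
def hamiltonianField (a b : E × E → E) (z : E × E) : E × E := (-b z, a z)

namespace HasLipschitzPartialGradients

variable {F : E × E → ℝ} {a b : E × E → E} {L : ℝ≥0}

theorem norm_fst_sub_le (h : HasLipschitzPartialGradients F a b L) (z w : E × E) :
    ‖a z - a w‖ ≤ L * ‖z - w‖ := by
  simpa [dist_eq_norm] using h.lipschitz_fst.dist_le_mul z w

theorem norm_snd_sub_le (h : HasLipschitzPartialGradients F a b L) (z w : E × E) :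
    ‖b z - b w‖ ≤ L * ‖z - w‖ := by
  simpa [dist_eq_norm] using h.lipschitz_snd.dist_le_mul z w

theorem lipschitz_hamiltonianField (h : HasLipschitzPartialGradients F a b L) :
    LipschitzWith L (hamiltonianField a b) := by
  have := h.lipschitz_snd.neg.prodMk h.lipschitz_fst
  rw [max_self] at this
  exact this

/-- The factor 2 comes from the sup norm on `E × E`: each of the two partial gradients contributes
`L`. -/
theorem norm_pairForm_sub_le (h : HasLipschitzPartialGradients F a b L) (z w : E × E) :
    ‖pairForm (a z) (b z) - pairForm (a w) (b w)‖ ≤ 2 * L * ‖z - w‖ := by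
  refine ContinuousLinearMap.opNorm_le_bound _ (by positivity) fun x => ?_
  have e : (pairForm (a z) (b z) - pairForm (a w) (b w)) x =
      inner ℝ (a z - a w) x.1 + inner ℝ (b z - b w) x.2 := by
    simp [inner_sub_left]; ring
  rw [e]
  have h1 := (abs_real_inner_le_norm (a z - a w) x.1).trans
    (mul_le_mul (h.norm_fst_sub_le z w) (norm_fst_le x) (norm_nonneg _) (by positivity))
  have h2 := (abs_real_inner_le_norm (b z - b w) x.2).trans
    (mul_le_mul (h.norm_snd_sub_le z w) (norm_snd_le x) (norm_nonneg _) (by positivity))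
  calc _ ≤ |inner ℝ (a z - a w) x.1| + |inner ℝ (b z - b w) x.2| := abs_add_le _ _
    _ ≤ _ := by linarith

/-- First order Taylor formula with quadratic remainder. -/
theorem abs_taylor_le (h : HasLipschitzPartialGradients F a b L) (z w : E × E) :
    |F w - F z - (inner ℝ (a z) (w.1 - z.1) + inner ℝ (b z) (w.2 - z.2))|
      ≤ 2 * L * ‖w - z‖ ^ 2 := by
  have := (convex_closedBall z ‖w - z‖).norm_image_sub_le_of_norm_hasFDerivWithin_le'
    (f := F) (f' := fun x => pairForm (a x) (b x)) (φ := pairForm (a z) (b z))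
    (C := 2 * L * ‖w - z‖) (x := z) (y := w)
    (fun x _ => (h.hasFDerivAt x).hasFDerivWithinAt)
    (fun x hx => (h.norm_pairForm_sub_le x z).trans (by
      rw [Metric.mem_closedBall, dist_eq_norm] at hx; gcongr))
    (by simp) (by simp [dist_eq_norm])
  rw [Real.norm_eq_abs, pairForm_apply] at this
  simpa [pow_two, mul_assoc] using this

end HasLipschitzPartialGradients

/-- First order Taylor formula with quadratic remainder for a Lipschitz gradient. -/
theorem abs_taylor_le_of_lipschitz_gradient {G : E → ℝ} {g : E → E} {K : ℝ≥0}
    (hG : ∀ x, HasFDerivAt G (innerSL ℝ (g x)) x) (hg : LipschitzWith K g) (x y : E) :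
    |G y - G x - inner ℝ (g x) (y - x)| ≤ K * ‖y - x‖ ^ 2 := by
  have := (convex_closedBall x ‖y - x‖).norm_image_sub_le_of_norm_hasFDerivWithin_le'
    (f := G) (f' := fun x => innerSL ℝ (g x)) (φ := innerSL ℝ (g x))
    (C := K * ‖y - x‖) (x := x) (y := y)
    (fun x _ => (hG x).hasFDerivWithinAt)
    (fun z hz => by
      rw [← map_sub, innerSL_apply_norm]
      have := hg.dist_le_mul z x
      rw [Metric.mem_closedBall] at hz
      rw [dist_eq_norm] at this
      exact this.trans (by gcongr))
    (by simp) (by simp [dist_eq_norm])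
  rw [Real.norm_eq_abs] at this
  simpa [pow_two, mul_assoc] using this

end PartialGradients

/-! ### Characteristics -/

section Characteristics

variable {E : Type*} [NormedAddCommGroup E] [InnerProductSpace ℝ E]

/-- `Z t y` is the value at time `t` of the characteristic which ends at time `T` in
`(y, g y)`. -/
structure IsCharacteristicFlow (a b : E × E → E) (g : E → E) (T : ℝ) (Z : ℝ → E → E × E) :
    Prop where
  terminal : ∀ y, Z T y = (y, g y)
  hasDerivAt : ∀ t y, HasDerivAt (fun s => Z s y) (hamiltonianField a b (Z t y)) t

/-- On `[0,T]`, the distance of two characteristics is controlled by that of their first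
components. -/
def IsGraphFlow (T N : ℝ) (Z : ℝ → E → E × E) : Prop :=
  ∀ t ∈ Icc 0 T, ∀ y y', ‖Z t y - Z t y'‖ ≤ N * ‖(Z t y).1 - (Z t y').1‖

variable {F : E × E → ℝ} {a b : E × E → E} {g : E → E} {L : ℝ≥0} {T N : ℝ}
  {Z : ℝ → E → E × E}

theorem exists_isCharacteristicFlow [CompleteSpace E] (hF : HasLipschitzPartialGradients F a b L)
    (ha : ContDiff ℝ 1 a) (hb : ContDiff ℝ 1 b) (g : E → E) (T : ℝ) :
    ∃ Z, IsCharacteristicFlow a b g T Z := by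
  have hV : ContDiff ℝ 1 (hamiltonianField a b) := hb.neg.prodMk ha
  choose γ hγ hγ' using fun y => exists_integralCurve_of_lipschitz hV
    hF.lipschitz_hamiltonianField T (y, g y)
  exact ⟨fun t y => γ y t, hγ, fun t y => hγ' y t⟩

namespace IsCharacteristicFlow

theorem hasDerivAt_fst (hZ : IsCharacteristicFlow a b g T Z) (t : ℝ) (y : E) :
    HasDerivAt (fun s => (Z s y).1) (-b (Z t y)) t :=
  (hZ.hasDerivAt t y).fst

theorem hasDerivAt_snd (hZ : IsCharacteristicFlow a b g T Z) (t : ℝ) (y : E) :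
    HasDerivAt (fun s => (Z s y).2) (a (Z t y)) t :=
  (hZ.hasDerivAt t y).snd

theorem continuous (hZ : IsCharacteristicFlow a b g T Z) (y : E) : Continuous fun t => Z t y :=
  continuous_iff_continuousAt.2 fun t => (hZ.hasDerivAt t y).continuousAt

theorem norm_flow_sub_le (hZ : IsCharacteristicFlow a b g T Z)
    (hF : HasLipschitzPartialGradients F a b L) (y y' : E) {s t : ℝ} (hs : s ∈ Icc 0 T)
    (ht : t ∈ Icc 0 T) : ‖Z t y - Z t y'‖ ≤ Real.exp (L * T) * ‖Z s y - Z s y'‖ := by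
  refine (norm_sub_le_exp_of_integralCurves hF.lipschitz_hamiltonianField
    (fun t => hZ.hasDerivAt t y) (fun t => hZ.hasDerivAt t y') s t).trans ?_
  gcongr
  exact abs_le.2 ⟨by linarith [hs.2, ht.1], by linarith [hs.1, ht.2]⟩

theorem norm_increment_sub_le (hZ : IsCharacteristicFlow a b g T Z)
    (hF : HasLipschitzPartialGradients F a b L) (y y' : E) {s t : ℝ} (hs : s ∈ Icc 0 T)
    (ht : t ∈ Icc 0 T) :
    ‖(Z t y - Z t y') - (Z s y - Z s y')‖
      ≤ L * (Real.exp (L * T) * ‖Z s y - Z s y'‖) * |t - s| := by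
  have := (convex_Icc (0 : ℝ) T).norm_image_sub_le_of_norm_hasDerivWithin_le
    (f := fun r => Z r y - Z r y')
    (f' := fun r => hamiltonianField a b (Z r y) - hamiltonianField a b (Z r y'))
    (C := L * (Real.exp (L * T) * ‖Z s y - Z s y'‖)) (x := s) (y := t)
    (fun r _ => ((hZ.hasDerivAt r y).sub (hZ.hasDerivAt r y')).hasDerivWithinAt)
    (fun r hr => ?_) hs ht
  · simpa using this
  · have h1 := hF.lipschitz_hamiltonianField.dist_le_mul (Z r y) (Z r y')
    rw [dist_eq_norm, dist_eq_norm] at h1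
    refine h1.trans ?_
    gcongr
    exact hZ.norm_flow_sub_le hF y y' hs hr

/-- A quadratic quantity which is nonincreasing in time along pairs of characteristics, and
positive on the terminal graph, keeps the flow a graph. -/
theorem isGraphFlow_of_antitone (hZ : IsCharacteristicFlow a b g T Z) (hT : 0 ≤ T)
    (hF : HasLipschitzPartialGradients F a b L) (q : E × E → ℝ) {c C : ℝ} (hc : 0 < c)
    (hC : 0 ≤ C)
    (hanti : ∀ y y', AntitoneOn (fun t => q (Z t y - Z t y')) (Icc 0 T))
    (hlower : ∀ y y', c * ‖Z T y - Z T y'‖ ^ 2 ≤ q (Z T y - Z T y'))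
    (hupper : ∀ z, q z ≤ C * (‖z‖ * ‖z.1‖)) :
    ∃ N, 0 ≤ N ∧ IsGraphFlow T N Z := by
  -- With `δ` the difference at time `t`: `c‖δ‖² ≤ e^{2LT} c‖δ_T‖² ≤ e^{2LT} q(δ_T) ≤ e^{2LT} q(δ) ≤
  -- e^{2LT} C‖δ‖‖δ.1‖`, and one factor `‖δ‖` is divided out.
  refine ⟨Real.exp (L * T) ^ 2 * C / c, by positivity, fun t ht y y' => ?_⟩
  have hTT : T ∈ Icc 0 T := ⟨hT, le_rfl⟩
  set δ := Z t y - Z t y' with hδ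
  have h1 : ‖δ‖ ≤ Real.exp (L * T) * ‖Z T y - Z T y'‖ := hZ.norm_flow_sub_le hF y y' hTT ht
  have h2 : c * ‖Z T y - Z T y'‖ ^ 2 ≤ C * (‖δ‖ * ‖δ.1‖) :=
    (hlower y y').trans ((hanti y y' ht hTT ht.2).trans (hupper _))
  have h3 : ‖δ‖ ^ 2 ≤ Real.exp (L * T) ^ 2 * ‖Z T y - Z T y'‖ ^ 2 := by
    rw [← mul_pow]; gcongr
  rcases eq_or_lt_of_le (norm_nonneg δ) with h0 | h0
  · rw [← h0]; positivity
  · have h4 : c * ‖δ‖ ^ 2 ≤ Real.exp (L * T) ^ 2 * (C * (‖δ‖ * ‖δ.1‖)) :=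
      calc c * ‖δ‖ ^ 2 ≤ c * (Real.exp (L * T) ^ 2 * ‖Z T y - Z T y'‖ ^ 2) := by gcongr
        _ = Real.exp (L * T) ^ 2 * (c * ‖Z T y - Z T y'‖ ^ 2) := by ring
        _ ≤ _ := by gcongr
    have h5 : c * ‖δ‖ ≤ Real.exp (L * T) ^ 2 * C * ‖δ.1‖ := by
      refine le_of_mul_le_mul_right ?_ h0
      linarith
    rw [div_mul_eq_mul_div, le_div_iff₀ hc]
    have : (Z t y).1 - (Z t y').1 = δ.1 := rfl
    rw [this]
    linarith

/-- For a right inverse `ψ` of the position map at time `s`, the graph property makes `x ↦ (Z t (ψ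
x)).1` a perturbation of the identity with Lipschitz constant at most `1/2` when `t` is close to
`s`. Hitting `w` is then a fixed point problem for a contraction. -/
theorem surjective_step [CompleteSpace E] (hZ : IsCharacteristicFlow a b g T Z)
    (hF : HasLipschitzPartialGradients F a b L) (hN : IsGraphFlow T N Z) {s t : ℝ}
    (hs : s ∈ Icc 0 T) (ht : t ∈ Icc 0 T)
    (hst : L * (Real.exp (L * T) * N) * |t - s| ≤ 1 / 2)
    (hsurj : Function.Surjective fun y => (Z s y).1) :
    Function.Surjective fun y => (Z t y).1 := by
  intro w
  choose ψ hψ using hsurj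
  have hψ : ∀ x, (Z s (ψ x)).1 = x := hψ
  have hlip : LipschitzWith (1 / 2) fun x => w - (Z t (ψ x)).1 + x := by
    refine LipschitzWith.of_dist_le_mul fun x x' => ?_
    rw [dist_eq_norm, dist_eq_norm]
    have h1 := hZ.norm_increment_sub_le hF (ψ x) (ψ x') hs ht
    have h2 := hN s hs (ψ x) (ψ x')
    rw [hψ, hψ] at h2
    have h3 := norm_fst_le ((Z t (ψ x) - Z t (ψ x')) - (Z s (ψ x) - Z s (ψ x')))
    have e : w - (Z t (ψ x)).1 + x - (w - (Z t (ψ x')).1 + x') =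
        -((Z t (ψ x) - Z t (ψ x')) - (Z s (ψ x) - Z s (ψ x'))).1 := by
      simp only [Prod.fst_sub, hψ]; abel
    rw [e, norm_neg]
    calc _ ≤ _ := h3
      _ ≤ _ := h1
      _ ≤ L * (Real.exp (L * T) * (N * ‖x - x'‖)) * |t - s| := by gcongr
      _ = L * (Real.exp (L * T) * N) * |t - s| * ‖x - x'‖ := by ring
      _ ≤ 1 / 2 * ‖x - x'‖ := by gcongr
      _ = _ := by push_cast; rfl
  have hcontr : ContractingWith (1 / 2) fun x => w - (Z t (ψ x)).1 + x :=
    ⟨by rw [← NNReal.coe_lt_coe]; norm_num, hlip⟩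
  have hfix := hcontr.fixedPoint_isFixedPt
  refine ⟨ψ (ContractingWith.fixedPoint _ hcontr), ?_⟩
  have : w - (Z t (ψ (ContractingWith.fixedPoint _ hcontr))).1 = 0 :=
    left_eq_add.1 (hfix.symm.trans (add_comm _ _))
  exact (sub_eq_zero.1 this).symm

/-- At `T` the position map is the identity. Since `N` is the same at all times, the admissible step
length is uniform and finitely many equal steps reach `t`. -/
theorem surjective_fst [CompleteSpace E] (hZ : IsCharacteristicFlow a b g T Z)
    (hF : HasLipschitzPartialGradients F a b L) (hN0 : 0 ≤ N) (hN : IsGraphFlow T N Z) {t : ℝ}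
    (ht : t ∈ Icc 0 T) : Function.Surjective fun y => (Z t y).1 := by
  set A : ℝ := L * (Real.exp (L * T) * N)
  have hA : 0 ≤ A := by positivity
  obtain ⟨n, hn⟩ := exists_nat_gt (2 * (A * (T - t)))
  have hTt : 0 ≤ T - t := by linarith [ht.2]
  have hn0 : (0 : ℝ) < n := lt_of_le_of_lt (by positivity) hn
  have key : ∀ k : ℕ, k ≤ n → Function.Surjective fun y => (Z (T - k * ((T - t) / n)) y).1 := by
    have hmem : ∀ k : ℕ, k ≤ n → T - k * ((T - t) / n) ∈ Icc 0 T := fun k hk => by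
      have h1 : (k : ℝ) * ((T - t) / n) ≤ n * ((T - t) / n) := by gcongr
      rw [mul_div_cancel₀ _ hn0.ne'] at h1
      have h2 : 0 ≤ (k : ℝ) * ((T - t) / n) := by positivity
      exact ⟨by linarith [ht.1], by linarith⟩
    intro k
    induction k with
    | zero => intro _ w; exact ⟨w, by simp [hZ.terminal]⟩
    | succ k ih =>
      intro hk
      refine hZ.surjective_step hF hN (hmem k (by omega)) (hmem _ hk) ?_ (ih (by omega))
      have e : T - ((k + 1 : ℕ) : ℝ) * ((T - t) / n) - (T - k * ((T - t) / n)) =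
          -((T - t) / n) := by push_cast; ring
      rw [e, abs_neg, abs_of_nonneg (by positivity), ← mul_div_assoc, div_le_iff₀ hn0]
      linarith
  have := key n le_rfl
  rwa [mul_div_cancel₀ _ hn0.ne', sub_sub_cancel] at this

end IsCharacteristicFlow

end Characteristics

/-! ### The value carried by the characteristics -/

section Value

variable {E : Type*} [NormedAddCommGroup E] [InnerProductSpace ℝ E]

/-- The linear form `(τ, ξ) ↦ c τ + ⟪v, ξ⟫` on space-time. -/
noncomputable def spaceTimeForm (c : ℝ) (v : E) : ℝ × E →L[ℝ] ℝ :=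
  c • ContinuousLinearMap.fst ℝ ℝ E + (innerSL ℝ v).comp (ContinuousLinearMap.snd ℝ ℝ E)

@[simp]
theorem spaceTimeForm_apply (c : ℝ) (v : E) (z : ℝ × E) :
    spaceTimeForm c v z = c * z.1 + inner ℝ v z.2 := rfl

/-- The terminal datum at the endpoint plus the action along the characteristic. -/
noncomputable def characteristicValue (F : E × E → ℝ) (b : E × E → E) (G : E → ℝ) (T : ℝ)
    (Z : ℝ → E → E × E) (t : ℝ) (y : E) : ℝ :=
  G y + ∫ s in T..t, (F (Z s y) - inner ℝ (Z s y).2 (b (Z s y)))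

variable {F : E × E → ℝ} {a b : E × E → E} {G : E → ℝ} {g : E → E} {L K : ℝ≥0} {T N : ℝ}
  {Z : ℝ → E → E × E}

namespace IsCharacteristicFlow

theorem hasDerivAt_characteristicValue (hZ : IsCharacteristicFlow a b g T Z)
    (hF : HasLipschitzPartialGradients F a b L) (t : ℝ) (y : E) :
    HasDerivAt (fun s => characteristicValue F b G T Z s y)
      (F (Z t y) - inner ℝ (Z t y).2 (b (Z t y))) t := by
  have hcont : Continuous fun s => F (Z s y) - inner ℝ (Z s y).2 (b (Z s y)) := by
    have h1 := hZ.continuous y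
    have h2 : Continuous F := continuous_iff_continuousAt.2 fun z => (hF.hasFDerivAt z).continuousAt
    exact (h2.comp h1).sub ((continuous_snd.comp h1).inner (hF.lipschitz_snd.continuous.comp h1))
  exact (intervalIntegral.integral_hasDerivAt_right (hcont.intervalIntegrable _ _)
    (hcont.stronglyMeasurableAtFilter _ _) hcont.continuousAt).const_add _

/-- The value has the costate as its space gradient, with quadratic error. At `T` the defect is the
Taylor remainder of `G`. Its time derivative is the Taylor remainder of `F` minus `ΔP·Δb`, because
the first-order terms cancel along the Hamiltonian system. Both are quadratic in the difference of
the characteristics, which the graph property bounds by the position difference at time `t`. -/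
theorem exists_abs_characteristicValue_sub_le (hZ : IsCharacteristicFlow a b g T Z) (hT : 0 ≤ T)
    (hF : HasLipschitzPartialGradients F a b L)
    (hG : ∀ x, HasFDerivAt G (innerSL ℝ (g x)) x) (hg : LipschitzWith K g)
    (hN : IsGraphFlow T N Z) :
    ∃ C, 0 ≤ C ∧ ∀ t ∈ Icc 0 T, ∀ y y',
      |characteristicValue F b G T Z t y' - characteristicValue F b G T Z t y
        - inner ℝ (Z t y).2 ((Z t y').1 - (Z t y).1)| ≤ C * ‖(Z t y').1 - (Z t y).1‖ ^ 2 := by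
  refine ⟨(K + 3 * L * T) * (Real.exp (L * T) * N) ^ 2, by positivity, fun t ht y y' => ?_⟩
  have hTT : T ∈ Icc 0 T := ⟨hT, le_rfl⟩
  set B : ℝ := Real.exp (L * T) * (N * ‖(Z t y').1 - (Z t y).1‖) with hB
  have hδ : ∀ s ∈ Icc 0 T, ‖Z s y' - Z s y‖ ≤ B := fun s hs =>
    (hZ.norm_flow_sub_le hF y' y ht hs).trans
      (mul_le_mul_of_nonneg_left (hN t ht y' y) (Real.exp_pos _).le)
  set D : ℝ → ℝ := fun s => characteristicValue F b G T Z s y' - characteristicValue F b G T Z s y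
        - inner ℝ (Z s y).2 ((Z s y').1 - (Z s y).1) with hD
  set D' : ℝ → ℝ := fun s => (F (Z s y') - F (Z s y) -
      (inner ℝ (a (Z s y)) ((Z s y').1 - (Z s y).1) + inner ℝ (b (Z s y)) ((Z s y').2 - (Z s y).2)))
      - inner ℝ ((Z s y').2 - (Z s y).2) (b (Z s y') - b (Z s y)) with hD'
  have hderiv : ∀ s, HasDerivAt D (D' s) s := fun s => by
    have h := ((hZ.hasDerivAt_characteristicValue (G := G) hF s y').sub
      (hZ.hasDerivAt_characteristicValue (G := G) hF s y)).sub
      ((hZ.hasDerivAt_snd s y).inner ℝ ((hZ.hasDerivAt_fst s y').sub (hZ.hasDerivAt_fst s y)))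
    refine h.congr_deriv ?_
    simp only [hD', Pi.sub_apply, inner_sub_left, inner_sub_right, inner_neg_right,
      real_inner_comm (b (Z s y))]
    ring
  have hbound : ∀ s ∈ Icc 0 T, ‖D' s‖ ≤ 3 * L * B ^ 2 := fun s hs => by
    have h1 := hF.abs_taylor_le (Z s y) (Z s y')
    have h2 : |inner ℝ ((Z s y').2 - (Z s y).2) (b (Z s y') - b (Z s y))| ≤ L * ‖Z s y' - Z s y‖ ^ 2 :=
      calc _ ≤ ‖(Z s y').2 - (Z s y).2‖ * ‖b (Z s y') - b (Z s y)‖ := abs_real_inner_le_norm _ _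
        _ ≤ ‖Z s y' - Z s y‖ * (L * ‖Z s y' - Z s y‖) := by
          gcongr
          · exact norm_snd_le (Z s y' - Z s y)
          · exact hF.norm_snd_sub_le _ _
        _ = _ := by ring
    have h3 : ‖Z s y' - Z s y‖ ^ 2 ≤ B ^ 2 := by gcongr; exact hδ s hs
    calc ‖D' s‖ ≤ _ := abs_sub _ _
      _ ≤ 2 * L * ‖Z s y' - Z s y‖ ^ 2 + L * ‖Z s y' - Z s y‖ ^ 2 := add_le_add h1 h2
      _ = 3 * L * ‖Z s y' - Z s y‖ ^ 2 := by ring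
      _ ≤ _ := by gcongr
  have hDT : |D T| ≤ K * B ^ 2 := by
    have h1 := abs_taylor_le_of_lipschitz_gradient hG hg y y'
    have h2 : ‖y' - y‖ ≤ B := by
      refine le_trans ?_ (hδ T hTT)
      rw [hZ.terminal, hZ.terminal]
      exact norm_fst_le ((y', g y') - (y, g y))
    have e : D T = G y' - G y - inner ℝ (g y) (y' - y) := by
      simp [hD, hZ.terminal, characteristicValue]
    rw [e]
    exact h1.trans (by gcongr)
  have hmv := (convex_Icc (0 : ℝ) T).norm_image_sub_le_of_norm_hasDerivWithin_le
    (f := D) (f' := D') (fun s _ => (hderiv s).hasDerivWithinAt) hbound hTT ht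
  have hTt : ‖t - T‖ ≤ T := abs_le.2 ⟨by linarith [ht.1], by linarith [ht.2]⟩
  calc |D t| = |(D t - D T) + D T| := by rw [sub_add_cancel]
    _ ≤ |D t - D T| + |D T| := abs_add_le _ _
    _ ≤ 3 * L * B ^ 2 * T + K * B ^ 2 := by
      refine add_le_add (hmv.trans ?_) hDT
      gcongr
    _ = _ := by rw [hB]; ring

/-- Equal positions force equal costates by the graph property, and then the two characteristics
agree up to time `T`. -/
theorem injective_fst (hZ : IsCharacteristicFlow a b g T Z)
    (hF : HasLipschitzPartialGradients F a b L) (hN : IsGraphFlow T N Z) {t : ℝ}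
    (ht : t ∈ Icc 0 T) : Function.Injective fun y => (Z t y).1 := by
  intro y y' h
  have hTT : T ∈ Icc 0 T := ⟨ht.1.trans ht.2, le_rfl⟩
  have h1 := hN t ht y y'
  have h0 : (Z t y).1 - (Z t y').1 = 0 := sub_eq_zero.2 h
  rw [h0, norm_zero, mul_zero] at h1
  have h2 := hZ.norm_flow_sub_le hF y y' ht hTT
  rw [le_antisymm h1 (norm_nonneg _), mul_zero, hZ.terminal, hZ.terminal] at h2
  exact congrArg Prod.fst (sub_eq_zero.1 (norm_le_zero_iff.1 h2))

/-- The costate, as a function of time and position, is locally Lipschitz. -/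
theorem locallyLipschitzOn_costate (hZ : IsCharacteristicFlow a b g T Z)
    (hF : HasLipschitzPartialGradients F a b L) (hN0 : 0 ≤ N) (hN : IsGraphFlow T N Z)
    {ψ : ℝ → E → E} (hψ : ∀ t ∈ Icc 0 T, ∀ x, (Z t (ψ t x)).1 = x) :
    LocallyLipschitzOn (Icc 0 T ×ˢ univ) fun z : ℝ × E => (Z z.1 (ψ z.1 z.2)).2 := by
  obtain ⟨B₀, hB₀⟩ := isCompact_Icc.exists_bound_of_continuousOn (s := Icc 0 T)
    (hZ.continuous 0).continuousOn
  obtain ⟨B₁, hB₁⟩ := isCompact_Icc.exists_bound_of_continuousOn (s := Icc 0 T)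
    (hF.lipschitz_hamiltonianField.continuous.comp (hZ.continuous 0)).continuousOn
  rintro ⟨t₀, x₀⟩ ⟨ht₀, -⟩
  have hB₀0 : 0 ≤ B₀ := (norm_nonneg _).trans (hB₀ t₀ ht₀)
  have hB₁0 : 0 ≤ B₁ := (norm_nonneg _).trans (hB₁ t₀ ht₀)
  set R : ℝ := ‖x₀‖ + 1 with hR
  have hR0 : 0 ≤ R := by positivity
  -- A common speed bound for all characteristics passing through the ball of radius `R` at some
  -- time of `[0,T]`, by comparison with the one ending over `0`.
  set B : ℝ := B₁ + L * (Real.exp (L * T) * (N * (R + B₀))) with hB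
  have hB0 : 0 ≤ B := by positivity
  have hspeed : ∀ t ∈ Icc 0 T, ∀ x, ‖x‖ ≤ R → ∀ s ∈ Icc 0 T,
      ‖hamiltonianField a b (Z s (ψ t x))‖ ≤ B := by
    intro t ht x hx s hs
    have h1 := hF.lipschitz_hamiltonianField.dist_le_mul (Z s (ψ t x)) (Z s 0)
    rw [dist_eq_norm, dist_eq_norm] at h1
    have h2 := hZ.norm_flow_sub_le hF (ψ t x) 0 ht hs
    have h3 := hN t ht (ψ t x) 0
    rw [hψ t ht] at h3
    have h4 : ‖x - (Z t 0).1‖ ≤ R + B₀ := (norm_sub_le _ _).trans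
      (add_le_add hx ((norm_fst_le _).trans (hB₀ t ht)))
    have h5 : ‖hamiltonianField a b (Z s (ψ t x)) - hamiltonianField a b (Z s 0)‖ ≤
        L * (Real.exp (L * T) * (N * (R + B₀))) := by
      refine h1.trans ?_
      gcongr
      refine h2.trans ?_
      gcongr
      refine h3.trans ?_
      gcongr
    have h6 := hB₁ s hs
    have h7 := norm_add_le (hamiltonianField a b (Z s (ψ t x)) - hamiltonianField a b (Z s 0))
      (hamiltonianField a b (Z s 0))
    rw [sub_add_cancel] at h7
    simp only [Function.comp] at h6
    linarith
  refine ⟨(N + (N + 1) * B).toNNReal,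
    (Icc 0 T ×ˢ univ) ∩ (univ ×ˢ Metric.ball x₀ 1), ?_, ?_⟩
  · refine inter_mem_nhdsWithin _ ?_
    exact prod_mem_nhds univ_mem (Metric.ball_mem_nhds _ one_pos)
  · refine LipschitzOnWith.of_dist_le_mul ?_
    rintro ⟨t', x'⟩ ⟨⟨ht', -⟩, -⟩ ⟨t, x⟩ ⟨⟨ht, -⟩, -, hx⟩
    simp only at ht ht' hx
    have hxR : ‖x‖ ≤ R := by
      rw [Metric.mem_ball, dist_eq_norm] at hx
      have := norm_add_le (x - x₀) x₀
      rw [sub_add_cancel] at this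
      linarith
    -- The two points are compared through the position at time `t'` of the characteristic through
    -- `(t, x)`: the speed bound handles the change of time, the graph property the change of
    -- position.
    have h1 : ‖Z t' (ψ t x) - Z t (ψ t x)‖ ≤ B * ‖t' - t‖ :=
      (convex_Icc (0 : ℝ) T).norm_image_sub_le_of_norm_hasDerivWithin_le
        (f := fun s => Z s (ψ t x))
        (fun s _ => (hZ.hasDerivAt s (ψ t x)).hasDerivWithinAt) (hspeed t ht x hxR) ht ht'
    have h2 := hN t' ht' (ψ t' x') (ψ t x)
    rw [hψ t' ht'] at h2
    have h3 : ‖x' - (Z t' (ψ t x)).1‖ ≤ ‖x' - x‖ + ‖Z t' (ψ t x) - Z t (ψ t x)‖ := by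
      have e : x' - (Z t' (ψ t x)).1 = (x' - x) - (Z t' (ψ t x) - Z t (ψ t x)).1 := by
        rw [Prod.fst_sub, hψ t ht]; abel
      rw [e]
      exact (norm_sub_le _ _).trans (by gcongr; exact norm_fst_le _)
    have h4 : ‖(Z t' (ψ t' x')).2 - (Z t (ψ t x)).2‖ ≤
        ‖Z t' (ψ t' x') - Z t' (ψ t x)‖ + ‖Z t' (ψ t x) - Z t (ψ t x)‖ := by
      have e : (Z t' (ψ t' x')).2 - (Z t (ψ t x)).2 =
          ((Z t' (ψ t' x') - Z t' (ψ t x)) + (Z t' (ψ t x) - Z t (ψ t x))).2 := by simp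
      rw [e]
      exact (norm_snd_le _).trans (norm_add_le _ _)
    have h5 : ‖t' - t‖ ≤ dist (t', x') (t, x) := le_max_left _ _
    have h6 : ‖x' - x‖ ≤ dist (t', x') (t, x) := by
      rw [← dist_eq_norm]; exact le_max_right _ _
    rw [dist_eq_norm]
    have h7 : ‖Z t' (ψ t' x') - Z t' (ψ t x)‖ ≤ N * (‖x' - x‖ + B * ‖t' - t‖) :=
      h2.trans (by gcongr; linarith)
    have h8 : N * (‖x' - x‖ + B * ‖t' - t‖) ≤
        N * (dist (t', x') (t, x) + B * dist (t', x') (t, x)) := by gcongr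
    have h9 : B * ‖t' - t‖ ≤ B * dist (t', x') (t, x) := by gcongr
    rw [Real.coe_toNNReal _ (by positivity)]
    calc _ ≤ _ := h4
      _ ≤ N * (dist (t', x') (t, x) + B * dist (t', x') (t, x)) + B * dist (t', x') (t, x) := by
        linarith
      _ = _ := by ring

/-- The value function is differentiable, up to the boundary of the strip, and its space gradient
is the costate. -/
theorem hasFDerivWithinAt_value (hZ : IsCharacteristicFlow a b g T Z) (hT : 0 ≤ T)
    (hF : HasLipschitzPartialGradients F a b L)
    (hG : ∀ x, HasFDerivAt G (innerSL ℝ (g x)) x) (hg : LipschitzWith K g)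
    (hN : IsGraphFlow T N Z)
    {ψ : ℝ → E → E} (hψ : ∀ t ∈ Icc 0 T, ∀ x, (Z t (ψ t x)).1 = x) {t : ℝ} (ht : t ∈ Icc 0 T)
    (x : E) :
    HasFDerivWithinAt (fun z : ℝ × E => characteristicValue F b G T Z z.1 (ψ z.1 z.2))
      (spaceTimeForm (F (x, (Z t (ψ t x)).2)) (Z t (ψ t x)).2) (Icc 0 T ×ˢ univ) (t, x) := by
  obtain ⟨C, hC0, hC⟩ := hZ.exists_abs_characteristicValue_sub_le hT hF hG hg hN
  set y := ψ t x with hy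
  have hx : (Z t y).1 = x := hψ t ht x
  have hfst : HasFDerivAt (fun z : ℝ × E => z.1) (ContinuousLinearMap.fst ℝ ℝ E) (t, x) :=
    hasFDerivAt_fst
  -- `m` is the displacement from the single characteristic through `(t, x)`, and `A` is the
  -- first-order model of the value around it. The value differs from `A` by `O(‖m‖²)`, which is
  -- negligible since `m` vanishes at `(t, x)`. In the time derivative of `A` the terms `∓⟪P, b⟫`
  -- cancel, leaving `F`.
  set m : ℝ × E → E := fun z => z.2 - (Z z.1 y).1 with hm
  set A : ℝ × E → ℝ := fun z => characteristicValue F b G T Z z.1 y + inner ℝ (Z z.1 y).2 (m z)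
  have hm' : HasFDerivAt m (ContinuousLinearMap.snd ℝ ℝ E -
      (ContinuousLinearMap.toSpanSingleton ℝ (-b (Z t y))).comp (ContinuousLinearMap.fst ℝ ℝ E))
      (t, x) :=
    hasFDerivAt_snd.sub (HasFDerivAt.comp (g := fun s => (Z s y).1) (t, x)
      (hZ.hasDerivAt_fst t y).hasFDerivAt hfst)
  have hmz : m (t, x) = 0 := by simp [hm, hx]
  have hA : HasFDerivAt A (spaceTimeForm (F (x, (Z t y).2)) (Z t y).2) (t, x) := by
    have h1 := HasFDerivAt.comp (g := fun s => characteristicValue F b G T Z s y) (t, x)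
      (hZ.hasDerivAt_characteristicValue (G := G) hF t y).hasFDerivAt hfst
    have h2 := HasFDerivAt.comp (g := fun s => (Z s y).2) (t, x)
      (hZ.hasDerivAt_snd t y).hasFDerivAt hfst
    refine (h1.add (h2.inner ℝ hm')).congr_fderiv ?_
    have hpair : (x, (Z t y).2) = Z t y := by rw [← hx]
    ext z
    · simp [hpair, hmz]
    · simp [hmz]
  have hAo := hA.isLittleO
  have hmO : m =O[𝓝 (t, x)] fun z => z - (t, x) := by
    simpa [hmz] using hm'.isBigO_sub
  have hm2 : (fun z => ‖m z‖ ^ 2) =o[𝓝 (t, x)] fun z => z - (t, x) := by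
    have h1 : m =o[𝓝 (t, x)] fun _ => (1 : ℝ) := by
      rw [Asymptotics.isLittleO_one_iff, ← hmz]
      exact hm'.continuousAt
    have := h1.norm_left.mul_isBigO hmO.norm_left.norm_right
    simpa [pow_two] using this
  refine HasFDerivWithinAt.of_isLittleO ?_
  have hR : (fun z : ℝ × E => characteristicValue F b G T Z z.1 (ψ z.1 z.2) - A z)
      =O[𝓝[Icc 0 T ×ˢ univ] (t, x)] fun z => ‖m z‖ ^ 2 := by
    refine Asymptotics.IsBigO.of_bound C ?_
    filter_upwards [self_mem_nhdsWithin] with z hz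
    have := hC z.1 hz.1 y (ψ z.1 z.2)
    rw [hψ z.1 hz.1] at this
    rw [norm_pow, norm_norm, Real.norm_eq_abs]
    convert this using 2
    simp only [A, hm]
    ring
  have := (hR.trans_isLittleO (hm2.mono nhdsWithin_le_nhds)).add (hAo.mono nhdsWithin_le_nhds)
  refine this.congr_left fun z => ?_
  have : A (t, x) = characteristicValue F b G T Z t (ψ t x) := by
    simp [A, hmz, hy]
  rw [this]
  ring

end IsCharacteristicFlow

end Value

/-! ### Uniqueness along characteristics -/

section Uniqueness

variable {E : Type*} [NormedAddCommGroup E] [InnerProductSpace ℝ E]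

/-- The squared gradient of a nonnegative function with Lipschitz gradient is controlled by the
function. -/
theorem norm_sq_gradient_le_of_nonneg {w : E → ℝ} {g : E → E} {x : E} {Λ B : ℝ} (hΛ : 0 ≤ Λ)
    (hw : ∀ x' ∈ Metric.closedBall x 1, HasFDerivAt w (innerSL ℝ (g x')) x')
    (hg : ∀ x' ∈ Metric.closedBall x 1, ‖g x' - g x‖ ≤ Λ * ‖x' - x‖) (hB : ‖g x‖ ≤ B)
    (hnonneg : ∀ x', 0 ≤ w x') : ‖g x‖ ^ 2 ≤ 2 * (2 * Λ + B + 1) * w x := by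
  have hB0 : 0 ≤ B := (norm_nonneg _).trans hB
  -- One gradient step of length `k⁻¹‖g x‖`: `k ≥ B` keeps it in the unit ball, and `k ≥ 2Λ` makes
  -- the remainder at most half the first-order decrease. Nonnegativity at the new point gives the
  -- bound.
  set k : ℝ := 2 * Λ + B + 1 with hk
  have hk0 : 0 < k := by positivity
  set x' : E := x - k⁻¹ • g x with hx'
  have hdiff : x' - x = -(k⁻¹ • g x) := by rw [hx']; abel
  have hnorm : ‖x' - x‖ = k⁻¹ * ‖g x‖ := by
    rw [hdiff, norm_neg, norm_smul, Real.norm_of_nonneg (by positivity)]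
  have hle1 : ‖x' - x‖ ≤ 1 := by
    rw [hnorm, inv_mul_le_iff₀ hk0]; linarith
  have hsub : Metric.closedBall x ‖x' - x‖ ⊆ Metric.closedBall x 1 :=
    Metric.closedBall_subset_closedBall hle1
  have h := (convex_closedBall x ‖x' - x‖).norm_image_sub_le_of_norm_hasFDerivWithin_le'
    (f := w) (f' := fun y => innerSL ℝ (g y)) (φ := innerSL ℝ (g x))
    (C := Λ * ‖x' - x‖) (x := x) (y := x')
    (fun y hy => (hw y (hsub hy)).hasFDerivWithinAt)
    (fun y hy => by
      rw [← map_sub, innerSL_apply_norm]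
      refine (hg y (hsub hy)).trans ?_
      rw [Metric.mem_closedBall, dist_eq_norm] at hy
      gcongr)
    (by simp) (by simp [dist_eq_norm])
  have h1 := (abs_le.1 h).2
  rw [innerSL_apply_apply, hdiff, inner_neg_right, inner_smul_right,
    real_inner_self_eq_norm_sq, ← hdiff, hnorm] at h1
  have h2 := hnonneg x'
  have h3 : Λ * (k⁻¹ * ‖g x‖) * (k⁻¹ * ‖g x‖) ≤ k⁻¹ * ‖g x‖ ^ 2 / 2 := by
    have h4 : Λ * k⁻¹ ≤ 1 / 2 := by
      rw [← div_eq_mul_inv, div_le_iff₀ hk0]; linarith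
    calc _ = Λ * k⁻¹ * (k⁻¹ * ‖g x‖ ^ 2) := by ring
      _ ≤ 1 / 2 * (k⁻¹ * ‖g x‖ ^ 2) := by gcongr
      _ = _ := by ring
  have h5 : k⁻¹ * ‖g x‖ ^ 2 ≤ 2 * w x := by linarith
  rw [inv_mul_le_iff₀ hk0] at h5
  linarith

theorem HasFDerivAt.hasFDerivAt_slice {u : ℝ × E → ℝ} {c : ℝ} {v : E} {t : ℝ} {x : E}
    (h : HasFDerivAt u (spaceTimeForm c v) (t, x)) :
    HasFDerivAt (fun y => u (t, y)) (innerSL ℝ v) x := by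
  refine (HasFDerivAt.comp (g := u) x h (hasFDerivAt_prodMk_right t x)).congr_fderiv ?_
  ext ξ
  simp

theorem HasFDerivAt.hasDerivAt_slice {u : ℝ × E → ℝ} {c : ℝ} {v : E} {t : ℝ} {x : E}
    (h : HasFDerivAt u (spaceTimeForm c v) (t, x)) :
    HasDerivAt (fun s => u (s, x)) c t := by
  have := HasFDerivAt.comp_hasDerivAt (l := u) (f := fun s => (s, x)) t h
    ((hasDerivAt_id t).prodMk (hasDerivAt_const t x))
  exact this.congr_deriv (by simp)

theorem HasFDerivAt.hasDerivAt_along {u : ℝ × E → ℝ} {c : ℝ} {v V : E} {X : ℝ → E} {t : ℝ}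
    (h : HasFDerivAt u (spaceTimeForm c v) (t, X t)) (hX : HasDerivAt X V t) :
    HasDerivAt (fun s => u (s, X s)) (c + Inner.inner ℝ v V) t := by
  have := HasFDerivAt.comp_hasDerivAt (l := u) (f := fun s => (s, X s)) t h
    ((hasDerivAt_id t).prodMk hX)
  exact this.congr_deriv (by simp)

/-- Two solutions of `-∂ₜu + F(x, ∂ₓu) = 0` with the same terminal values agree, provided that the
characteristics of one of them fill the strip. -/
theorem eqOn_of_characteristics [ProperSpace E] {F : E × E → ℝ} {a b : E × E → E} {L : ℝ≥0}
    {T : ℝ} (hT : 0 ≤ T) (hF : HasLipschitzPartialGradients F a b L)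
    (hconv : ∀ x p q, F (x, p) + inner ℝ (b (x, p)) (q - p) ≤ F (x, q))
    {u v : ℝ × E → ℝ} {p q : ℝ × E → E}
    (hu : ContinuousOn u (Icc 0 T ×ˢ univ)) (hv : ContinuousOn v (Icc 0 T ×ˢ univ))
    (hp : LocallyLipschitzOn (Icc 0 T ×ˢ univ) p) (hq : LocallyLipschitzOn (Icc 0 T ×ˢ univ) q)
    (hup : ∀ t ∈ Ioo 0 T, ∀ x, HasFDerivAt u (spaceTimeForm (F (x, p (t, x))) (p (t, x))) (t, x))
    (hvq : ∀ t ∈ Ioo 0 T, ∀ x, HasFDerivAt v (spaceTimeForm (F (x, q (t, x))) (q (t, x))) (t, x))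
    (hterm : ∀ x, u (T, x) = v (T, x))
    (hchar : ∀ t ∈ Icc 0 T, ∀ x, ∃ X : ℝ → E, X t = x ∧
      ∀ s ∈ Icc 0 T, HasDerivAt X (-b (X s, p (s, X s))) s) :
    EqOn v u (Icc 0 T ×ˢ univ) := by
  have hTT : T ∈ Icc 0 T := ⟨hT, le_rfl⟩
  -- The convexity gap of `F(x, ·)` between the two gradients: it is nonnegative, and `-e` is the
  -- derivative of `u - v` along characteristics of `u`.
  set e : ℝ × E → ℝ := fun z =>
    F (z.2, q z) - F (z.2, p z) - inner ℝ (b (z.2, p z)) (q z - p z) with he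
  have hderiv : ∀ X : ℝ → E, (∀ s ∈ Icc 0 T, HasDerivAt X (-b (X s, p (s, X s))) s) →
      ∀ s ∈ Ioo 0 T, HasDerivAt (fun s => u (s, X s) - v (s, X s)) (-e (s, X s)) s := by
    intro X hX s hs
    have h := ((hup s hs (X s)).hasDerivAt_along (hX s (Ioo_subset_Icc_self hs))).sub
      ((hvq s hs (X s)).hasDerivAt_along (hX s (Ioo_subset_Icc_self hs)))
    refine h.congr_deriv ?_
    simp only [he, inner_neg_right, inner_sub_right, real_inner_comm (b (X s, p (s, X s)))]
    ring
  have hXcont : ∀ X : ℝ → E, (∀ s ∈ Icc 0 T, HasDerivAt X (-b (X s, p (s, X s))) s) →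
      ContinuousOn X (Icc 0 T) := fun X hX s hs => (hX s hs).continuousAt.continuousWithinAt
  have hcont : ∀ X : ℝ → E, (∀ s ∈ Icc 0 T, HasDerivAt X (-b (X s, p (s, X s))) s) →
      ContinuousOn (fun s => u (s, X s) - v (s, X s)) (Icc 0 T) := by
    intro X hX
    have hpath : ContinuousOn (fun s => (s, X s)) (Icc 0 T) :=
      continuousOn_id.prodMk (hXcont X hX)
    have hmaps : MapsTo (fun s => (s, X s)) (Icc 0 T) (Icc 0 T ×ˢ univ) :=
      fun s hs => ⟨hs, mem_univ _⟩
    exact (hu.comp hpath hmaps).sub (hv.comp hpath hmaps)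
  have hnonneg : ∀ t ∈ Icc 0 T, ∀ x, 0 ≤ u (t, x) - v (t, x) := by
    intro t ht x
    obtain ⟨X, hXt, hX⟩ := hchar t ht x
    have hanti : AntitoneOn (fun s => u (s, X s) - v (s, X s)) (Icc 0 T) := by
      refine antitoneOn_of_deriv_nonpos (convex_Icc _ _) (hcont X hX) ?_ ?_
      · rw [interior_Icc]
        exact fun s hs => (hderiv X hX s hs).differentiableAt.differentiableWithinAt
      · rw [interior_Icc]
        intro s hs
        rw [(hderiv X hX s hs).deriv, he]
        have := hconv (X s) (p (s, X s)) (q (s, X s))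
        simp only
        linarith
    have := hanti ht hTT ht.2
    simp only [hterm, hXt, sub_self] at this
    exact this
  rintro ⟨t, x⟩ ⟨ht, -⟩
  obtain ⟨X, hXt, hX⟩ := hchar t ht x
  obtain ⟨R, hR⟩ := isCompact_Icc.exists_bound_of_continuousOn (hXcont X hX)
  -- The extra `1` leaves room for the unit balls around `X s` in the gradient estimate.
  have hcompact : IsCompact (Icc 0 T ×ˢ Metric.closedBall (0 : E) (R + 1)) :=
    isCompact_Icc.prod (isCompact_closedBall _ _)
  have hsub : Icc 0 T ×ˢ Metric.closedBall (0 : E) (R + 1) ⊆ Icc 0 T ×ˢ univ :=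
    prod_mono_right (subset_univ _)
  obtain ⟨Kp, hKp⟩ := (hp.mono hsub).exists_lipschitzOnWith_of_compact hcompact
  obtain ⟨Kq, hKq⟩ := (hq.mono hsub).exists_lipschitzOnWith_of_compact hcompact
  obtain ⟨B, hB⟩ := hcompact.exists_bound_of_continuousOn
    (hKp.continuousOn.sub hKq.continuousOn)
  -- Product of the Taylor constant in `e ≤ 2L‖p - q‖²` and the constant in `‖p - q‖² ≤ 2(2Λ + B +
  -- 1)(u - v)` with `Λ = Kp + Kq`.
  set k : ℝ := 2 * L * (2 * (2 * (Kp + Kq) + B + 1)) with hk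
  have hgrad : ∀ s ∈ Ioo 0 T, e (s, X s) ≤ k * (u (s, X s) - v (s, X s)) := by
    intro s hs
    have hs' := Ioo_subset_Icc_self hs
    have hball : ∀ x' ∈ Metric.closedBall (X s) 1,
        (s, x') ∈ Icc 0 T ×ˢ Metric.closedBall (0 : E) (R + 1) := by
      intro x' hx'
      refine ⟨hs', ?_⟩
      rw [Metric.mem_closedBall, dist_eq_norm] at hx'
      rw [mem_closedBall_zero_iff]
      have h1 := norm_add_le (x' - X s) (X s)
      rw [sub_add_cancel] at h1
      linarith [hR s hs']
    have hXs := hball (X s) (Metric.mem_closedBall_self zero_le_one)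
    have h1 := norm_sq_gradient_le_of_nonneg (w := fun x' => u (s, x') - v (s, x'))
      (g := fun x' => p (s, x') - q (s, x')) (x := X s) (Λ := Kp + Kq) (B := B) (by positivity)
      (fun x' _ => by
        rw [map_sub]
        exact (hup s hs x').hasFDerivAt_slice.sub (hvq s hs x').hasFDerivAt_slice)
      (fun x' hx' => by
        have h1 := hKp.dist_le_mul _ (hball x' hx') _ hXs
        have h2 := hKq.dist_le_mul _ (hball x' hx') _ hXs
        have hd : dist (s, x') (s, X s) = ‖x' - X s‖ := by
          rw [dist_prod_same_left, dist_eq_norm]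
        rw [hd, dist_eq_norm] at h1 h2
        have e1 : p (s, x') - q (s, x') - (p (s, X s) - q (s, X s)) =
          (p (s, x') - p (s, X s)) - (q (s, x') - q (s, X s)) := by abel
        rw [e1, add_mul]
        exact (norm_sub_le _ _).trans (add_le_add h1 h2))
      (hB _ hXs) (fun x' => hnonneg s hs' x')
    have h2 := (abs_le.1 (hF.abs_taylor_le (X s, p (s, X s)) (X s, q (s, X s)))).2
    have h3 : ‖((X s, q (s, X s)) : E × E) - (X s, p (s, X s))‖ = ‖p (s, X s) - q (s, X s)‖ := by
      rw [norm_sub_rev, Prod.mk_sub_mk, sub_self, Prod.norm_mk, norm_zero,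
        max_eq_right (norm_nonneg _)]
    rw [h3] at h2
    simp only [sub_self, inner_zero_right, zero_add] at h2
    calc e (s, X s) ≤ 2 * L * ‖p (s, X s) - q (s, X s)‖ ^ 2 := h2
      _ ≤ 2 * L * (2 * (2 * (Kp + Kq) + B + 1) * (u (s, X s) - v (s, X s))) := by gcongr
      _ = _ := by rw [hk]; ring
  have hmono : MonotoneOn (fun s => Real.exp (k * s) * (u (s, X s) - v (s, X s))) (Icc 0 T) := by
    have hd : ∀ s ∈ Ioo 0 T, HasDerivAt
        (fun s => Real.exp (k * s) * (u (s, X s) - v (s, X s)))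
        (Real.exp (k * s) * (k * 1) * (u (s, X s) - v (s, X s)) +
          Real.exp (k * s) * (-e (s, X s))) s := fun s hs =>
      (((hasDerivAt_id s).const_mul k).exp).mul (hderiv X hX s hs)
    refine monotoneOn_of_deriv_nonneg (convex_Icc _ _)
      ((by fun_prop : ContinuousOn (fun s => Real.exp (k * s)) (Icc 0 T)).mul (hcont X hX)) ?_ ?_
    · rw [interior_Icc]
      exact fun s hs => (hd s hs).differentiableAt.differentiableWithinAt
    · rw [interior_Icc]
      intro s hs
      rw [(hd s hs).deriv]
      have h1 := hgrad s hs
      have h2 : 0 ≤ Real.exp (k * s) * (k * (u (s, X s) - v (s, X s)) - e (s, X s)) :=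
        mul_nonneg (Real.exp_pos _).le (by linarith)
      linarith
  have h1 := hmono ht hTT ht.2
  simp only [hterm, hXt, sub_self, mul_zero] at h1
  have h2 : u (t, x) - v (t, x) ≤ 0 := by
    by_contra! hpos
    exact absurd h1 (not_le.2 (mul_pos (Real.exp_pos _) hpos))
  linarith [hnonneg t ht x]

end Uniqueness

/-! ### Classical solutions of class `C^{1,1}_loc` -/

section Solutions

theorem LocallyLipschitz.comp_locallyLipschitzOn {α β γ : Type*} [PseudoEMetricSpace α]
    [PseudoEMetricSpace β] [PseudoEMetricSpace γ] {f : β → γ} {g : α → β} {s : Set α}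
    (hf : LocallyLipschitz f) (hg : LocallyLipschitzOn s g) : LocallyLipschitzOn s (f ∘ g) := by
  intro x hx
  obtain ⟨Kg, A, hA, hgA⟩ := hg hx
  obtain ⟨Kf, B, hB, hfB⟩ := hf (g x)
  refine ⟨Kf * Kg, A ∩ g ⁻¹' B, inter_mem hA (hg.continuousOn x hx hB), ?_⟩
  exact hfB.comp (hgA.mono inter_subset_left) fun y hy => hy.2

variable {d : ℕ} {F : EuclideanSpace ℝ (Fin d) × EuclideanSpace ℝ (Fin d) → ℝ}
  {G : EuclideanSpace ℝ (Fin d) → ℝ} {T : ℝ} {u : ℝ × EuclideanSpace ℝ (Fin d) → ℝ}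

theorem strip_mem_nhds {t : ℝ} (ht : t ∈ Ioo 0 T) (x : EuclideanSpace ℝ (Fin d)) :
    strip d T ∈ 𝓝 (t, x) :=
  prod_mem_nhds (Icc_mem_nhds ht.1 ht.2) univ_mem

theorem uniqueDiffOn_strip (hT : 0 < T) : UniqueDiffOn ℝ (strip d T) :=
  (uniqueDiffOn_Icc hT).prod uniqueDiffOn_univ

theorem HasFDerivAt.hasGradientAt_slice {c t : ℝ} {v x : EuclideanSpace ℝ (Fin d)}
    (h : HasFDerivAt u (spaceTimeForm c v) (t, x)) :
    HasGradientAt (fun y => u (t, y)) v x :=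
  h.hasFDerivAt_slice

/-- A function whose derivative on the strip is `F(x, p) dt + p dx` with `p` locally Lipschitz
is a solution. -/
theorem isC11LocSolutionHJB_of_hasFDerivWithinAt (hT : 0 < T) (hF : ContDiff ℝ 1 F)
    {p : ℝ × EuclideanSpace ℝ (Fin d) → EuclideanSpace ℝ (Fin d)}
    (hp : LocallyLipschitzOn (strip d T) p)
    (hu : ∀ z ∈ strip d T,
      HasFDerivWithinAt u (spaceTimeForm (F (z.2, p z)) (p z)) (strip d T) z)
    (hterm : ∀ x, u (T, x) = G x) : IsC11LocSolutionHJB F G T u where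
  regular := by
    refine ⟨fun z hz => (hu z hz).differentiableWithinAt, ?_⟩
    have hform : ContDiff ℝ 1 fun z : EuclideanSpace ℝ (Fin d) × EuclideanSpace ℝ (Fin d) =>
        spaceTimeForm (F z) z.2 := by
      unfold spaceTimeForm
      exact (hF.smul contDiff_const).add
        (((innerSL ℝ).contDiff.comp contDiff_snd).clm_comp contDiff_const)
    have hpair : LocallyLipschitzOn (strip d T)
        fun z : ℝ × EuclideanSpace ℝ (Fin d) => (z.2, p z) := by
      intro z hz
      obtain ⟨K, A, hA, hpA⟩ := hp hz
      exact ⟨max 1 K, A, hA, LipschitzWith.prod_snd.lipschitzOnWith.prodMk hpA⟩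
    have hcomp := hform.locallyLipschitz.comp_locallyLipschitzOn hpair
    intro z hz
    obtain ⟨K, A, hA, hKA⟩ := hcomp hz
    refine ⟨K, A ∩ strip d T, inter_mem hA self_mem_nhdsWithin, ?_⟩
    intro z₁ hz₁ z₂ hz₂
    rw [(hu z₁ hz₁.2).fderivWithin (uniqueDiffOn_strip hT z₁ hz₁.2),
      (hu z₂ hz₂.2).fderivWithin (uniqueDiffOn_strip hT z₂ hz₂.2)]
    exact hKA hz₁.1 hz₂.1
  equation t ht x := by
    have h := (hu (t, x) ⟨Ioo_subset_Icc_self ht, mem_univ _⟩).hasFDerivAt (strip_mem_nhds ht x)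
    rw [h.hasDerivAt_slice.deriv, h.hasGradientAt_slice.gradient]
    exact neg_add_cancel _
  terminal := hterm

/-- The costate is the Riesz representative of the spatial part of the derivative within the strip,
and the equation itself identifies the time derivative as `F(x, p)`. -/
theorem IsC11LocSolutionHJB.exists_costate (hu : IsC11LocSolutionHJB F G T u) :
    ∃ p : ℝ × EuclideanSpace ℝ (Fin d) → EuclideanSpace ℝ (Fin d),
      LocallyLipschitzOn (strip d T) p ∧ ∀ t ∈ Ioo 0 T, ∀ x,
        HasFDerivAt u (spaceTimeForm (F (x, p (t, x))) (p (t, x))) (t, x) := by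
  set p : ℝ × EuclideanSpace ℝ (Fin d) → EuclideanSpace ℝ (Fin d) := fun z => (InnerProductSpace.toDual ℝ (EuclideanSpace ℝ (Fin d))).symm
    ((fderivWithin ℝ u (strip d T) z).comp (ContinuousLinearMap.inr ℝ ℝ (EuclideanSpace ℝ (Fin d)))) with hp
  refine ⟨p, ?_, fun t ht x => ?_⟩
  · have hlin : LocallyLipschitz fun A : ℝ × EuclideanSpace ℝ (Fin d) →L[ℝ] ℝ =>
        (InnerProductSpace.toDual ℝ (EuclideanSpace ℝ (Fin d))).symm (A.comp (ContinuousLinearMap.inr ℝ ℝ (EuclideanSpace ℝ (Fin d)))) := by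
      refine ContDiff.locallyLipschitz (𝕂 := ℝ) ?_
      exact (InnerProductSpace.toDual ℝ (EuclideanSpace ℝ (Fin d))).symm.contDiff.comp
        (contDiff_id.clm_comp contDiff_const)
    exact hlin.comp_locallyLipschitzOn hu.regular.2
  · have hmem : (t, x) ∈ strip d T := ⟨Ioo_subset_Icc_self ht, mem_univ _⟩
    have h := (hu.regular.1 (t, x) hmem).hasFDerivWithinAt.hasFDerivAt (strip_mem_nhds ht x)
    set D := fderivWithin ℝ u (strip d T) (t, x) with hD
    have hpD : ∀ ξ : EuclideanSpace ℝ (Fin d), inner ℝ (p (t, x)) ξ = D (0, ξ) := fun ξ => by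
      simp [hp, ← hD]
    have hform : D = spaceTimeForm (D (1, 0)) (p (t, x)) := by
      ext z
      · simp
      · simp [hpD]
    have h' := h
    rw [hform] at h'
    have heq := hu.equation t ht x
    rw [h'.hasDerivAt_slice.deriv, h'.hasGradientAt_slice.gradient] at heq
    rw [show F (x, p (t, x)) = D (1, 0) by linarith, ← hform]
    exact h

end Solutions

/-! ### Well-posedness from the graph property -/

section WellPosed

/-- The problem is well-posed as soon as its characteristics form a graph on `[0,T]`. -/
theorem wellPosedHJB_of_isGraphFlow {d : ℕ}
    {F : EuclideanSpace ℝ (Fin d) × EuclideanSpace ℝ (Fin d) → ℝ}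
    {a b : EuclideanSpace ℝ (Fin d) × EuclideanSpace ℝ (Fin d) → EuclideanSpace ℝ (Fin d)}
    {G : EuclideanSpace ℝ (Fin d) → ℝ} {g : EuclideanSpace ℝ (Fin d) → EuclideanSpace ℝ (Fin d)}
    {L K : ℝ≥0} {T N : ℝ}
    {Z : ℝ → EuclideanSpace ℝ (Fin d) → EuclideanSpace ℝ (Fin d) × EuclideanSpace ℝ (Fin d)}
    (hT : 0 < T) (hFc : ContDiff ℝ 1 F) (hF : HasLipschitzPartialGradients F a b L)
    (hconv : ∀ x p q, F (x, p) + inner ℝ (b (x, p)) (q - p) ≤ F (x, q))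
    (hG : ∀ x, HasFDerivAt G (innerSL ℝ (g x)) x) (hg : LipschitzWith K g)
    (hZ : IsCharacteristicFlow a b g T Z) (hN0 : 0 ≤ N) (hN : IsGraphFlow T N Z) :
    WellPosedHJB F G T := by
  set ψ : ℝ → EuclideanSpace ℝ (Fin d) → EuclideanSpace ℝ (Fin d) :=
    fun t => Function.invFun fun y => (Z t y).1 with hψdef
  have hψ : ∀ t ∈ Icc 0 T, ∀ x, (Z t (ψ t x)).1 = x := fun t ht x =>
    Function.rightInverse_invFun (hZ.surjective_fst hF hN0 hN ht) x
  have hψ' : ∀ t ∈ Icc 0 T, ∀ y, ψ t (Z t y).1 = y := fun t ht y =>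
    Function.leftInverse_invFun (hZ.injective_fst hF hN ht) y
  have hTT : T ∈ Icc 0 T := ⟨hT.le, le_rfl⟩
  have hpL := hZ.locallyLipschitzOn_costate hF hN0 hN hψ
  have huD : ∀ z ∈ strip d T, _ := fun z hz =>
    hZ.hasFDerivWithinAt_value hT.le hF hG hg hN hψ (t := z.1) hz.1 z.2
  have hterm : ∀ x, characteristicValue F b G T Z T (ψ T x) = G x := fun x => by
    have h := hψ T hTT x
    rw [hZ.terminal] at h
    have h : ψ T x = x := h
    simp [characteristicValue, h]
  refine ⟨fun z => characteristicValue F b G T Z z.1 (ψ z.1 z.2),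
    isC11LocSolutionHJB_of_hasFDerivWithinAt hT hFc hpL huD hterm, fun v hv => ?_⟩
  obtain ⟨q, hqL, hq⟩ := hv.exists_costate
  refine eqOn_of_characteristics hT.le hF hconv (fun z hz => (huD z hz).continuousWithinAt)
    hv.regular.1.continuousOn hpL hqL
    (fun t ht x => (huD (t, x) ⟨Ioo_subset_Icc_self ht, mem_univ _⟩).hasFDerivAt
      (strip_mem_nhds ht x)) hq (fun x => (hterm x).trans (hv.terminal x).symm) ?_
  intro t ht x
  refine ⟨fun s => (Z s (ψ t x)).1, hψ t ht x, fun s hs => ?_⟩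
  simp only [hψ' s hs]
  exact hZ.hasDerivAt_fst s _

end WellPosed

/-! ### Graph property for strongly perturbed Hamiltonians -/

section Cone

theorem norm_le_norm_fst_add_norm_snd {V W : Type*} [SeminormedAddCommGroup V]
    [SeminormedAddCommGroup W] (z : V × W) : ‖z‖ ≤ ‖z.1‖ + ‖z.2‖ :=
  max_le (by linarith [norm_nonneg z.2]) (by linarith [norm_nonneg z.1])

variable {E : Type*} [NormedAddCommGroup E] [InnerProductSpace ℝ E]
  {H : E × E → ℝ} {a b : E × E → E} {g : E → E} {K k : ℝ≥0} {α m T : ℝ} {Z : ℝ → E → E × E}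

namespace HasLipschitzPartialGradients

theorem add_mul_inner (hH : HasLipschitzPartialGradients H a b K) (α : ℝ) :
    HasLipschitzPartialGradients (fun z => H z + α * inner ℝ z.1 z.2)
      (fun z => a z + α • z.2) (fun z => b z + α • z.1) (K + ‖α‖₊) where
  hasFDerivAt z := by
    have h := (hH.hasFDerivAt z).add
      (((hasFDerivAt_fst (𝕜 := ℝ) (p := z)).inner ℝ (hasFDerivAt_snd (𝕜 := ℝ) (p := z))).const_mul α)
    refine h.congr_fderiv ?_
    ext ξ
    · simp [inner_add_left, inner_smul_left, real_inner_comm]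
    · simp [inner_add_left, inner_smul_left]
  lipschitz_fst := by
    have h := (lipschitzWith_smul α).comp (LipschitzWith.prod_snd (α := E) (β := E))
    rw [mul_one] at h
    exact hH.lipschitz_fst.add h
  lipschitz_snd := by
    have h := (lipschitzWith_smul α).comp (LipschitzWith.prod_fst (α := E) (β := E))
    rw [mul_one] at h
    exact hH.lipschitz_snd.add h

theorem sub_mul_norm_sq (hH : HasLipschitzPartialGradients H a b K) (α : ℝ) :
    HasLipschitzPartialGradients (fun z => H z - α * (‖z.1‖ ^ 2 / 2))
      (fun z => a z - α • z.1) b (K + ‖α‖₊) where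
  hasFDerivAt z := by
    have h := (hH.hasFDerivAt z).sub
      (((hasFDerivAt_fst (𝕜 := ℝ) (p := z)).norm_sq).const_mul (α / 2))
    refine (h.congr_fderiv ?_).congr_of_eventuallyEq (.of_forall fun w => ?_)
    · ext ξ
      · simp [inner_sub_left, inner_smul_left]
        ring
      · simp
    · simp only [Pi.sub_apply]
      ring
  lipschitz_fst := by
    have h := (lipschitzWith_smul α).comp (LipschitzWith.prod_fst (α := E) (β := E))
    rw [mul_one] at h
    exact hH.lipschitz_fst.sub h
  lipschitz_snd := hH.lipschitz_snd.weaken le_self_add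

end HasLipschitzPartialGradients

theorem IsCharacteristicFlow.norm_terminal_sub_le (hZ : IsCharacteristicFlow a b g T Z)
    (hg : LipschitzWith k g) (y y' : E) :
    ‖(Z T y - Z T y').2‖ ≤ k * ‖(Z T y - Z T y').1‖ ∧
      ‖Z T y - Z T y'‖ ≤ (k + 1) * ‖(Z T y - Z T y').1‖ := by
  have h : ‖(Z T y - Z T y').2‖ ≤ k * ‖(Z T y - Z T y').1‖ := by
    simpa [hZ.terminal, dist_eq_norm] using hg.dist_le_mul y y'
  exact ⟨h, (norm_le_norm_fst_add_norm_snd _).trans (by linarith)⟩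

/-- The perturbation `α x ⬝ p` keeps the characteristics a graph. -/
theorem IsCharacteristicFlow.exists_isGraphFlow_add_mul_inner
    (hH : HasLipschitzPartialGradients H a b K) (hg : LipschitzWith k g) (hT : 0 ≤ T)
    (hα : 2 * K * (k + 1 : ℝ) ^ 2 ≤ α)
    (hZ : IsCharacteristicFlow (fun z => a z + α • z.2) (fun z => b z + α • z.1) g T Z) :
    ∃ N, 0 ≤ N ∧ IsGraphFlow T N Z := by
  set M : ℝ := k + 1 with hM
  have hk : (0 : ℝ) ≤ k := k.2
  have hK : (0 : ℝ) ≤ K := K.2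
  have hM1 : 1 ≤ M := by linarith
  -- On the terminal graph `|p| ≤ k|x|` and `‖δ‖ ≤ M|x|`, so the form is at least `(M² - k²)|x|² ≥
  -- |x|² ≥ M⁻²‖δ‖²`.
  refine hZ.isGraphFlow_of_antitone hT (hH.add_mul_inner α)
    (fun z => M ^ 2 * ‖z.1‖ ^ 2 - ‖z.2‖ ^ 2) (c := (M ^ 2)⁻¹) (C := M ^ 2)
    (by positivity) (by positivity) (fun y y' => ?_) (fun y y' => ?_) (fun z => ?_)
  · have hd := fun t => (((((hZ.hasDerivAt_fst t y).sub (hZ.hasDerivAt_fst t y')).norm_sq).const_mul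
      (M ^ 2)).sub ((hZ.hasDerivAt_snd t y).sub (hZ.hasDerivAt_snd t y')).norm_sq)
    refine (antitone_of_hasDerivAt_nonpos hd fun t => ?_).antitoneOn _
    set δ := Z t y - Z t y' with hδ
    have e1 : -(b (Z t y) + α • (Z t y).1) - -(b (Z t y') + α • (Z t y').1) =
        -(b (Z t y) - b (Z t y')) - α • δ.1 := by
      rw [hδ, Prod.fst_sub, smul_sub]; abel
    have e2 : a (Z t y) + α • (Z t y).2 - (a (Z t y') + α • (Z t y').2) =
        (a (Z t y) - a (Z t y')) + α • δ.2 := by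
      rw [hδ, Prod.snd_sub, smul_sub]; abel
    simp only [Pi.sub_apply, Pi.zero_apply, e1, e2]
    rw [show (Z t y).1 - (Z t y').1 = δ.1 from rfl, show (Z t y).2 - (Z t y').2 = δ.2 from rfl,
      inner_sub_right, inner_neg_right, inner_add_right, inner_smul_right, inner_smul_right,
      real_inner_self_eq_norm_sq, real_inner_self_eq_norm_sq]
    have hδ' := norm_le_norm_fst_add_norm_snd δ
    have h1 : -(‖δ.1‖ * (K * (‖δ.1‖ + ‖δ.2‖))) ≤ inner ℝ δ.1 (b (Z t y) - b (Z t y')) := by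
      refine (abs_le.1 ((abs_real_inner_le_norm _ _).trans ?_)).1
      gcongr
      exact (hH.norm_snd_sub_le _ _).trans (by gcongr)
    have h2 : -(‖δ.2‖ * (K * (‖δ.1‖ + ‖δ.2‖))) ≤ inner ℝ δ.2 (a (Z t y) - a (Z t y')) := by
      refine (abs_le.1 ((abs_real_inner_le_norm _ _).trans ?_)).1
      gcongr
      exact (hH.norm_fst_sub_le _ _).trans (by gcongr)
    have h3 := norm_nonneg δ.1
    have h4 := norm_nonneg δ.2
    generalize inner ℝ δ.1 (b (Z t y) - b (Z t y')) = r at *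
    generalize inner ℝ δ.2 (a (Z t y) - a (Z t y')) = s at *
    generalize ‖δ.1‖ = x at *
    generalize ‖δ.2‖ = p at *
    -- The perturbation contributes `-2α(M²x² + p²)` to the derivative and the increments of `a`,
    -- `b` at most `2KM²(x + p)²`. The threshold `α ≥ 2KM²` and `(x + p)² ≤ 2(x² + p²)` give the
    -- sign.
    have hM2 : 1 ≤ M ^ 2 := one_le_pow₀ hM1
    have h5 : M ^ 2 * -r ≤ M ^ 2 * (x * (K * (x + p))) := by gcongr; linarith
    have h6 : p * (K * (x + p)) ≤ M ^ 2 * (p * (K * (x + p))) :=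
      le_mul_of_one_le_left (by positivity) hM2
    have h7 : K * M ^ 2 * (x + p) ^ 2 ≤ α / 2 * (x + p) ^ 2 := by
      gcongr; linarith
    have hα0 : 0 ≤ α := le_trans (by positivity) hα
    have h8 : α / 2 * (x + p) ^ 2 ≤ α * (x ^ 2 + p ^ 2) := by
      nlinarith [mul_nonneg hα0 (sq_nonneg (x - p))]
    have h9 : α * x ^ 2 ≤ M ^ 2 * (α * x ^ 2) := le_mul_of_one_le_left (by positivity) hM2
    nlinarith
  · obtain ⟨h1, h2⟩ := hZ.norm_terminal_sub_le hg y y'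
    have h3 := norm_nonneg (Z T y - Z T y').1
    have h4 : ‖Z T y - Z T y'‖ ^ 2 ≤ M ^ 2 * ‖(Z T y - Z T y').1‖ ^ 2 := by
      rw [← mul_pow]; gcongr
    have h5 : ‖(Z T y - Z T y').2‖ ^ 2 ≤ (k : ℝ) ^ 2 * ‖(Z T y - Z T y').1‖ ^ 2 := by
      rw [← mul_pow]; gcongr
    rw [inv_mul_le_iff₀ (by positivity)]
    refine h4.trans ?_
    gcongr
    have h6 : 1 * ‖(Z T y - Z T y').1‖ ^ 2 ≤ (M ^ 2 - k ^ 2) * ‖(Z T y - Z T y').1‖ ^ 2 := by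
      gcongr
      rw [hM]; nlinarith
    linarith
  · have h1 : ‖z.1‖ ^ 2 ≤ ‖z‖ * ‖z.1‖ := by
      rw [pow_two]; gcongr; exact norm_fst_le z
    have h2 : M ^ 2 * ‖z.1‖ ^ 2 ≤ M ^ 2 * (‖z‖ * ‖z.1‖) := by gcongr
    linarith [sq_nonneg ‖z.2‖]

/-- The perturbation `-α |x|² / 2` keeps the characteristics a graph. -/
theorem IsCharacteristicFlow.exists_isGraphFlow_sub_mul_norm_sq
    (hH : HasLipschitzPartialGradients H a b K) (hg : LipschitzWith k g) (hT : 0 ≤ T) (hm : 0 < m)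
    (hmono : ∀ x p q, m * ‖q - p‖ ^ 2 ≤ inner ℝ (q - p) (b (x, q) - b (x, p)))
    (hα : K + 2 * (k + 1) * K + (K + (k + 1) * K) ^ 2 / m ≤ α)
    (hZ : IsCharacteristicFlow (fun z => a z - α • z.1) b g T Z) :
    ∃ N, 0 ≤ N ∧ IsGraphFlow T N Z := by
  set M : ℝ := k + 1 with hM
  have hk : (0 : ℝ) ≤ k := k.2
  have hK : (0 : ℝ) ≤ K := K.2
  have hM1 : 1 ≤ M := by linarith
  -- On the terminal graph `p·x ≥ -k|x|²`, so the form is at least `(M - k)|x|² = |x|² ≥ M⁻²‖δ‖²`.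
  refine hZ.isGraphFlow_of_antitone hT (hH.sub_mul_norm_sq α)
    (fun z => inner ℝ z.2 z.1 + M * ‖z.1‖ ^ 2) (c := (M ^ 2)⁻¹) (C := 1 + M)
    (by positivity) (by positivity) (fun y y' => ?_) (fun y y' => ?_) (fun z => ?_)
  · have hd := fun t => (((hZ.hasDerivAt_snd t y).sub (hZ.hasDerivAt_snd t y')).inner ℝ
      ((hZ.hasDerivAt_fst t y).sub (hZ.hasDerivAt_fst t y'))).add
      ((((hZ.hasDerivAt_fst t y).sub (hZ.hasDerivAt_fst t y')).norm_sq).const_mul M)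
    refine (antitone_of_hasDerivAt_nonpos hd fun t => ?_).antitoneOn _
    set δ := Z t y - Z t y' with hδ
    have e1 : -b (Z t y) - -b (Z t y') = -(b (Z t y) - b (Z t y')) := by abel
    have e2 : a (Z t y) - α • (Z t y).1 - (a (Z t y') - α • (Z t y').1) =
        (a (Z t y) - a (Z t y')) - α • δ.1 := by
      rw [hδ, Prod.fst_sub, smul_sub]; abel
    simp only [Pi.sub_apply, Pi.zero_apply, e1, e2]
    rw [show (Z t y).1 - (Z t y').1 = δ.1 from rfl, show (Z t y).2 - (Z t y').2 = δ.2 from rfl,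
      inner_neg_right, inner_neg_right, inner_sub_left, inner_smul_left,
      real_inner_self_eq_norm_sq]
    simp only [conj_trivial]
    have hδ' := norm_le_norm_fst_add_norm_snd δ
    have h1 : -(‖δ.1‖ * (K * (‖δ.1‖ + ‖δ.2‖))) ≤ inner ℝ δ.1 (b (Z t y) - b (Z t y')) := by
      refine (abs_le.1 ((abs_real_inner_le_norm _ _).trans ?_)).1
      gcongr
      exact (hH.norm_snd_sub_le _ _).trans (by gcongr)
    have h2 : inner ℝ (a (Z t y) - a (Z t y')) δ.1 ≤ K * (‖δ.1‖ + ‖δ.2‖) * ‖δ.1‖ := by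
      refine (real_inner_le_norm _ _).trans ?_
      gcongr
      exact (hH.norm_fst_sub_le _ _).trans (by gcongr)
    -- The increment of `b` is split into a change of `p` at fixed `x`, which is strongly monotone,
    -- and a change of `x` at fixed `p`, which is only Lipschitz.
    have h0 : m * ‖δ.2‖ ^ 2 - ‖δ.2‖ * (K * ‖δ.1‖) ≤ inner ℝ δ.2 (b (Z t y) - b (Z t y')) := by
      have e3 : b (Z t y) - b (Z t y') = (b ((Z t y).1, (Z t y).2) - b ((Z t y).1, (Z t y').2)) +
          (b ((Z t y).1, (Z t y').2) - b ((Z t y').1, (Z t y').2)) := by simp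
      rw [e3, inner_add_right]
      have h3 := hmono (Z t y).1 (Z t y').2 (Z t y).2
      have h4 : -(‖δ.2‖ * (K * ‖δ.1‖)) ≤
          inner ℝ δ.2 (b ((Z t y).1, (Z t y').2) - b ((Z t y').1, (Z t y').2)) := by
        refine (abs_le.1 ((abs_real_inner_le_norm _ _).trans ?_)).1
        gcongr
        refine (hH.norm_snd_sub_le _ _).trans (le_of_eq ?_)
        rw [Prod.mk_sub_mk, sub_self, Prod.norm_mk, norm_zero, max_eq_left (norm_nonneg _)]
        rfl
      rw [show (Z t y).2 - (Z t y').2 = δ.2 from rfl] at h3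
      linarith
    have h3 := norm_nonneg δ.1
    have h4 := norm_nonneg δ.2
    generalize inner ℝ δ.1 (b (Z t y) - b (Z t y')) = r at *
    generalize inner ℝ δ.2 (b (Z t y) - b (Z t y')) = r' at *
    generalize inner ℝ (a (Z t y) - a (Z t y')) δ.1 = s at *
    generalize ‖δ.1‖ = x at *
    generalize ‖δ.2‖ = p at *
    have h5 : M * -r ≤ M * (x * (K * (x + p))) := by gcongr; linarith
    have h6 : (K + 2 * M * K + (K + M * K) ^ 2 / m) * x ^ 2 ≤ α * x ^ 2 := by gcongr
    -- The derivative is at most `(K + 2MK - α)x² + 2(K + MK)xp - mp²`. Completing the square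
    -- absorbs the cross term and explains the threshold on `α`.
    have h7 : 2 * (K + M * K) * x * p ≤ (K + M * K) ^ 2 / m * x ^ 2 + m * p ^ 2 := by
      have e : (K + M * K) ^ 2 / m * x ^ 2 + m * p ^ 2 - 2 * (K + M * K) * x * p =
          ((K + M * K) * x - m * p) ^ 2 / m := by field_simp; ring
      have : 0 ≤ ((K + M * K) * x - m * p) ^ 2 / m := by positivity
      linarith
    nlinarith
  · obtain ⟨h1, h2⟩ := hZ.norm_terminal_sub_le hg y y'
    have h3 := norm_nonneg (Z T y - Z T y').1
    have h4 : ‖Z T y - Z T y'‖ ^ 2 ≤ M ^ 2 * ‖(Z T y - Z T y').1‖ ^ 2 := by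
      rw [← mul_pow]; gcongr
    have h5 : -(k * ‖(Z T y - Z T y').1‖ * ‖(Z T y - Z T y').1‖) ≤
        inner ℝ (Z T y - Z T y').2 (Z T y - Z T y').1 := by
      refine (abs_le.1 ((abs_real_inner_le_norm _ _).trans ?_)).1
      gcongr
    rw [inv_mul_le_iff₀ (by positivity)]
    refine h4.trans ?_
    gcongr
    rw [hM]
    linarith
  · have h1 : ‖z.1‖ ^ 2 ≤ ‖z‖ * ‖z.1‖ := by
      rw [pow_two]; gcongr; exact norm_fst_le z
    have h2 : M * ‖z.1‖ ^ 2 ≤ M * (‖z‖ * ‖z.1‖) := by gcongr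
    have h3 : inner ℝ z.2 z.1 ≤ ‖z‖ * ‖z.1‖ :=
      (real_inner_le_norm _ _).trans (by gcongr; exact norm_snd_le z)
    linarith

end Cone

/-! ### Functions of class `C²` with bounded second derivative -/

section SecondDerivative

theorem lipschitzWith_fderiv_of_norm_iteratedFDeriv_le {V : Type*} [NormedAddCommGroup V]
    [NormedSpace ℝ V] {f : V → ℝ} {C : ℝ} (hf : ContDiff ℝ 2 f)
    (hC : ∀ x, ‖iteratedFDeriv ℝ 2 f x‖ ≤ C) : LipschitzWith C.toNNReal (fderiv ℝ f) := by
  have hdiff : Differentiable ℝ (fderiv ℝ f) :=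
    (hf.fderiv_right (m := 1) (by norm_num)).differentiable (by norm_num)
  refine lipschitzWith_of_nnnorm_fderiv_le hdiff fun x => ?_
  rw [← NNReal.coe_le_coe, coe_nnnorm]
  have h : ‖fderiv ℝ (fderiv ℝ f) x‖ = ‖iteratedFDeriv ℝ 2 f x‖ := by
    rw [← norm_iteratedFDeriv_one, norm_iteratedFDeriv_fderiv]
  rw [h]
  exact (hC x).trans (Real.le_coe_toNNReal C)

variable {E : Type*} [NormedAddCommGroup E] [InnerProductSpace ℝ E]

theorem exists_lipschitz_gradient [CompleteSpace E] {G : E → ℝ} {C : ℝ} (hG : ContDiff ℝ 2 G)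
    (hC : ∀ x, ‖iteratedFDeriv ℝ 2 G x‖ ≤ C) :
    ∃ g : E → E, (∀ x, HasFDerivAt G (innerSL ℝ (g x)) x) ∧ LipschitzWith C.toNNReal g := by
  refine ⟨gradient G, fun x => ?_, ?_⟩
  · exact ((hG.differentiable (by norm_num)) x).hasGradientAt
  · have h := (InnerProductSpace.toDual ℝ E).symm.lipschitz.comp
      (lipschitzWith_fderiv_of_norm_iteratedFDeriv_le hG hC)
    rw [one_mul] at h
    exact h

theorem exists_lipschitz_partialGradients [CompleteSpace E] {H : E × E → ℝ} {C : ℝ} (hH : ContDiff ℝ 2 H)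
    (hC : ∀ z, ‖iteratedFDeriv ℝ 2 H z‖ ≤ C) :
    ∃ a b : E × E → E, ContDiff ℝ 1 a ∧ ContDiff ℝ 1 b ∧
      HasLipschitzPartialGradients H a b C.toNNReal := by
  have hlip := lipschitzWith_fderiv_of_norm_iteratedFDeriv_le hH hC
  have hsmooth : ContDiff ℝ 1 (fderiv ℝ H) := hH.fderiv_right (by norm_num)
  have key : ∀ ι : E →L[ℝ] E × E, ‖ι‖ ≤ 1 →
      ContDiff ℝ 1 (fun z => (InnerProductSpace.toDual ℝ E).symm ((fderiv ℝ H z).comp ι)) ∧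
      LipschitzWith C.toNNReal
        (fun z => (InnerProductSpace.toDual ℝ E).symm ((fderiv ℝ H z).comp ι)) := by
    intro ι hι
    refine ⟨(InnerProductSpace.toDual ℝ E).symm.contDiff.comp (hsmooth.clm_comp contDiff_const),
      LipschitzWith.of_dist_le_mul fun z w => ?_⟩
    rw [LinearIsometryEquiv.dist_map, dist_eq_norm, ← ContinuousLinearMap.sub_comp]
    have h := hlip.dist_le_mul z w
    rw [dist_eq_norm] at h
    calc _ ≤ ‖fderiv ℝ H z - fderiv ℝ H w‖ * ‖ι‖ := ContinuousLinearMap.opNorm_comp_le _ _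
      _ ≤ ‖fderiv ℝ H z - fderiv ℝ H w‖ * 1 := by gcongr
      _ ≤ _ := by rwa [mul_one]
  obtain ⟨ha, ha'⟩ := key _ (ContinuousLinearMap.norm_inl_le_one ℝ E E)
  obtain ⟨hb, hb'⟩ := key _ (ContinuousLinearMap.norm_inr_le_one ℝ E E)
  refine ⟨_, _, ha, hb, fun z => ?_, ha', hb'⟩
  refine ((hH.differentiable (by norm_num)) z).hasFDerivAt.congr_fderiv ?_
  ext ξ <;> simp

/-- The gradient inequality for a differentiable convex function. -/
theorem ConvexOn.add_inner_le_of_hasFDerivAt {f : E → ℝ} (hf : ConvexOn ℝ univ f) {v p : E}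
    (hv : HasFDerivAt f (innerSL ℝ v) p) (q : E) : f p + Inner.inner ℝ v (q - p) ≤ f q := by
  have hline := hf.comp_affineMap (AffineMap.lineMap p q : ℝ →ᵃ[ℝ] E)
  have hd : HasDerivAt (f ∘ (AffineMap.lineMap p q : ℝ →ᵃ[ℝ] E)) (Inner.inner ℝ v (q - p)) 0 := by
    have h0 : HasFDerivAt f (innerSL ℝ v) ((AffineMap.lineMap p q : ℝ →ᵃ[ℝ] E) 0) := by
      simpa using hv
    exact h0.comp_hasDerivAt 0 AffineMap.hasDerivAt_lineMap
  have h := hline.le_slope_of_hasDerivAt (mem_univ 0) (mem_univ 1) one_pos hd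
  simp [slope_def_field] at h
  linarith

/-- This is the gradient inequality for the convex function `f - m/2 ‖·‖²`, after expanding the
square. -/
theorem StrongConvexOn.add_inner_add_le_of_hasFDerivAt {f : E → ℝ} {m : ℝ}
    (hf : StrongConvexOn univ m f) {v p : E} (hv : HasFDerivAt f (innerSL ℝ v) p) (q : E) :
    f p + Inner.inner ℝ v (q - p) + m / 2 * ‖q - p‖ ^ 2 ≤ f q := by
  have hd : HasFDerivAt (fun x => f x - m / 2 * ‖x‖ ^ 2) (innerSL ℝ (v - m • p)) p := by
    refine (hv.sub (((hasFDerivAt_id (𝕜 := ℝ) p).norm_sq).const_mul (m / 2))).congr_fderiv ?_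
    ext ξ
    simp
    ring
  have h := (strongConvexOn_iff_convex.1 hf).add_inner_le_of_hasFDerivAt hd q
  rw [inner_sub_left, inner_smul_left, inner_sub_right p, real_inner_self_eq_norm_sq] at h
  rw [norm_sub_sq_real, real_inner_comm p q]
  simp only [conj_trivial] at h
  linarith

theorem HasLipschitzPartialGradients.hasFDerivAt_snd_slice {H : E × E → ℝ} {a b : E × E → E}
    {L : ℝ≥0} (hH : HasLipschitzPartialGradients H a b L) (x p : E) :
    HasFDerivAt (fun q => H (x, q)) (innerSL ℝ (b (x, p))) p := by
  refine (HasFDerivAt.comp (g := H) p (hH.hasFDerivAt (x, p))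
    (hasFDerivAt_prodMk_right x p)).congr_fderiv ?_
  ext ξ
  simp

end SecondDerivative

theorem mainTheorem2 (KG KH m : ℝ) (hm : 0 < m) :
    ∃ C : ℝ, 0 < C ∧
      ∀ (d : ℕ) (H : EuclideanSpace ℝ (Fin d) × EuclideanSpace ℝ (Fin d) → ℝ)
        (G : EuclideanSpace ℝ (Fin d) → ℝ),
        ContDiff ℝ 2 H → ContDiff ℝ 2 G →
        (∀ z, ‖iteratedFDeriv ℝ 2 H z‖ ≤ KH) →
        (∀ x, ‖iteratedFDeriv ℝ 2 G x‖ ≤ KG) →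
        (∀ x, StrongConvexOn Set.univ m (fun p => H (x, p))) →
        ∀ α : ℝ, C < α →
          (∀ T : ℝ, 0 < T → WellPosedHJB (fun z => H z + α * inner ℝ z.1 z.2) G T) ∧
          (∀ T : ℝ, 0 < T → WellPosedHJB (fun z => H z - α * (‖z.1‖ ^ 2 / 2)) G T) := by
  set K : ℝ≥0 := KH.toNNReal
  set k : ℝ≥0 := KG.toNNReal
  set C₁ : ℝ := 2 * K * (k + 1 : ℝ) ^ 2 with hC₁
  set C₂ : ℝ := K + 2 * (k + 1) * K + (K + (k + 1) * K) ^ 2 / m with hC₂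
  have hC₁0 : 0 ≤ C₁ := by positivity
  have hC₂0 : 0 ≤ C₂ := by positivity
  -- The sum exceeds the thresholds of both perturbations, and the `1` makes it positive even when
  -- they vanish.
  refine ⟨C₁ + C₂ + 1, by positivity, ?_⟩
  intro d H G hH hG hHK hGK hconv α hα
  obtain ⟨a, b, ha, hb, hab⟩ := exists_lipschitz_partialGradients hH hHK
  obtain ⟨g, hg, hgL⟩ := exists_lipschitz_gradient hG hGK
  have hH1 : ContDiff ℝ 1 H := hH.of_le (by norm_num)
  have hstrong : ∀ x p q, H (x, p) + inner ℝ (b (x, p)) (q - p) + m / 2 * ‖q - p‖ ^ 2 ≤ H (x, q) :=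
    fun x p q => (hconv x).add_inner_add_le_of_hasFDerivAt (hab.hasFDerivAt_snd_slice x p) q
  have hweak : ∀ x p q, H (x, p) + inner ℝ (b (x, p)) (q - p) ≤ H (x, q) := fun x p q => by
    have h1 := hstrong x p q
    have h2 : 0 ≤ m / 2 * ‖q - p‖ ^ 2 := by positivity
    linarith
  refine ⟨fun T hT => ?_, fun T hT => ?_⟩
  · have hF := hab.add_mul_inner α
    obtain ⟨Z, hZ⟩ := exists_isCharacteristicFlow hF (ha.add (contDiff_snd.const_smul α))
      (hb.add (contDiff_fst.const_smul α)) g T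
    obtain ⟨N, hN0, hN⟩ := hZ.exists_isGraphFlow_add_mul_inner hab hgL hT.le (by linarith)
    refine wellPosedHJB_of_isGraphFlow hT ?_ hF (fun x p q => ?_) hg hgL hZ hN0 hN
    · exact hH1.add (contDiff_const.mul (contDiff_fst.inner ℝ contDiff_snd))
    -- The term `α x·p` is linear in `p`, so the gradient inequality in `p` persists.
    · have h := hweak x p q
      simp only [inner_add_left, inner_smul_left, inner_sub_right x, conj_trivial]
      linarith
  · have hF := hab.sub_mul_norm_sq α
    obtain ⟨Z, hZ⟩ := exists_isCharacteristicFlow hF (ha.sub (contDiff_fst.const_smul α)) hb g T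
    have hmono : ∀ x p q, m * ‖q - p‖ ^ 2 ≤ inner ℝ (q - p) (b (x, q) - b (x, p)) := by
      -- Adding the strong convexity inequalities at `p` and at `q` gives strong monotonicity of
      -- `∂ₚH`.
      intro x p q
      have h1 := hstrong x p q
      have h2 := hstrong x q p
      rw [norm_sub_rev, ← neg_sub q p, inner_neg_right] at h2
      rw [real_inner_comm, inner_sub_left]
      linarith
    obtain ⟨N, hN0, hN⟩ :=
      hZ.exists_isGraphFlow_sub_mul_norm_sq hab hgL hT.le hm hmono (by linarith)
    refine wellPosedHJB_of_isGraphFlow hT ?_ hF (fun x p q => ?_) hg hgL hZ hN0 hN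
    · exact hH1.sub (contDiff_const.mul ((contDiff_fst.norm_sq ℝ).div_const 2))
    · have h := hweak x p q
      linarith
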